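/- Consider the $K$-user MIMO broadcast channel with reconfigurable antennas: the transmitter has $M$ antennas, and user $k\in\{1,\dots,K\}$ has $L_k\ge 1$ RF-chains, each time instant choosing $L_k$ distinct receiving modes out of $N_k\ge L_k$ preset modes. The noiseless received signal of user $k$ at time $t$ is $\Gamma_k(t)H_k x(t)\in\mathbb{C}^{L_k}$, where $x(t)\in\mathbb{C}^M$ is the transmitted vector, $\Gamma_k(t)\in\{0,1\}^{L_k\times N_k}$ is a selection matrix (each row has exactly one entry $1$, and the rows are pairwise different), and the channel matrices $H_k\in\mathbb{C}^{N_k\times M}$ are constant in time, all their entries (over all users) being i.i.d. with a continuous, i.e. atomless, distribution on $\mathbb{C}$. For a block length $n$ let $H_k^n=I_n\otimes H_k$ and $\Gamma_k^n=\operatorname{diag}(\Gamma_k(1),\dots,\Gamma_k(n))$, and let $\mathcal{R}(A)$ denote the column space of a matrix $A$. A tuple $(d_1,\dots,d_K)\in\mathbb{R}^K$ is called achievable if for every $n$ there are numbers $m_k(n)\in\mathbb{N}$, beamforming matrices $V_k^n\in\mathbb{C}^{nM\times m_k(n)}$ and selection matrices forming $\Gamma_k^n$ $(k=1,\dots,K)$,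 none of them depending on the channel realization, such that almost surely, for every $k$, the orthogonal projection of $\mathcal{R}(\Gamma_k^nH_k^nV_k^n)$ onto the orthogonal complement of $\mathcal{I}_k=\mathcal{R}(\Gamma_k^nH_k^n[V_1^n\cdots V_{k-1}^n\,V_{k+1}^n\cdots V_K^n])$ has dimension $m_k(n)$, and $\lim_{n\to\infty}m_k(n)/n=d_k$ for every $k$. The LDoF (linear degrees of freedom) region $\mathcal{D}$ is the closure in $\mathbb{R}^K$ of the set of achievable tuples. Let $L_{\max}=\max_k L_k$ and $T_k=\min(M,N_k)$. If $M>L_{\max}$ and $N_k>L_{\max}$ for every $k$, then $$\mathcal{D}=\Big\{(d_1,\dots,d_K)\in\mathbb{R}^K:\ d_k\ge 0\ \text{ and }\ \frac{d_k}{L_k}+\sum_{j\neq k}\frac{d_j}{T_j}\le 1\ \text{ for all } k\Big\}.$$ -/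

import Mathlib

open MeasureTheory ProbabilityTheory Filter Topology

/-- `Γ ∈ {0,1}^{L × N}` is a selection matrix: every row has exactly one entry equal to one and
zeros elsewhere, and the rows are pairwise different. -/
def IsSelectionMatrix {L N : ℕ} (Γ : Matrix (Fin L) (Fin N) ℂ) : Prop :=
  (∀ l, ∃ i, Γ l = Pi.single i 1) ∧ Function.Injective Γ

/-- The column space `R(A)`, as a subspace of a complex Euclidean space. -/
noncomputable def colSpace {r c : Type*} [Fintype r] [Fintype c] [DecidableEq c]
    (A : Matrix r c ℂ) : Submodule ℂ (EuclideanSpace ℂ r) :=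
  LinearMap.range (Matrix.toEuclideanLin A)

/-- `Proj_{Aᶜ} B`: the image of the subspace `B` under the orthogonal projection onto the
orthogonal complement of the subspace `A`. -/
noncomputable def projCompl {r : Type*} [Fintype r] (A B : Submodule ℂ (EuclideanSpace ℂ r)) :
    Submodule ℂ (EuclideanSpace ℂ r) :=
  B.map Aᗮ.starProjection.toLinearMap

/-- The effective channel `Γⁿ Hⁿ` of one user over `n` channel uses, where
`Γⁿ = diag(Γ(1), …, Γ(n))` and `Hⁿ = diag(H, …, H) = I_n ⊗ H`.
A coordinate of the extended space is labelled by the pair (antenna, time). -/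
def extendedChannel {M N L n : ℕ} (Γ : Fin n → Matrix (Fin L) (Fin N) ℂ)
    (H : Matrix (Fin N) (Fin M) ℂ) : Matrix (Fin L × Fin n) (Fin M × Fin n) ℂ :=
  Matrix.blockDiagonal Γ * Matrix.blockDiagonal (fun _ : Fin n => H)

/-- The matrix `[V_1 ⋯ V_{k-1} V_{k+1} ⋯ V_K]` that juxtaposes the columns of all the beamforming
matrices except those of user `k`. -/
def othersBeam {K : ℕ} {r : Type*} {m : Fin K → ℕ} (V : ∀ k, Matrix r (Fin (m k)) ℂ)
    (k : Fin K) : Matrix r (Σ j : {j : Fin K // j ≠ k}, Fin (m j)) ℂ :=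
  Matrix.of fun i p => V p.1 i p.2

/-- The interference space `I_k = R(Γ_kⁿ H_kⁿ [V_1 ⋯ V_{k-1} V_{k+1} ⋯ V_K])` at user `k`. -/
noncomputable def interferenceSpace {K M n : ℕ} {N L m : Fin K → ℕ}
    (Γ : ∀ k, Fin n → Matrix (Fin (L k)) (Fin (N k)) ℂ)
    (H : ∀ k, Matrix (Fin (N k)) (Fin M) ℂ)
    (V : ∀ k, Matrix (Fin M × Fin n) (Fin (m k)) ℂ) (k : Fin K) :
    Submodule ℂ (EuclideanSpace ℂ (Fin (L k) × Fin n)) :=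
  colSpace (extendedChannel (Γ k) (H k) * othersBeam V k)

/-- The signal space `R(Γ_kⁿ H_kⁿ V_k)` of user `k`. -/
noncomputable def signalSpace {K M n : ℕ} {N L m : Fin K → ℕ}
    (Γ : ∀ k, Fin n → Matrix (Fin (L k)) (Fin (N k)) ℂ)
    (H : ∀ k, Matrix (Fin (N k)) (Fin M) ℂ)
    (V : ∀ k, Matrix (Fin M × Fin n) (Fin (m k)) ℂ) (k : Fin K) :
    Submodule ℂ (EuclideanSpace ℂ (Fin (L k) × Fin n)) :=
  colSpace (extendedChannel (Γ k) (H k) * V k)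

/-- The tuple `d` is an achievable LDoF tuple for the broadcast channel with `M` transmit antennas
and random, time-invariant channel matrices `H ω k` (`N k` preset modes at user `k`, of which
`L k` are chosen at every time instant). For each block length `n` the numbers of symbols `m n k`,
the beamforming matrices `V n k` and the selection matrices `Γ n k t` are chosen without knowledge
of the channel realization `ω`; almost surely every user can decode all of its symbols. -/
def IsAchievableLDoF {K M : ℕ} {N : Fin K → ℕ} (L : Fin K → ℕ)
    {Ω : Type*} [MeasurableSpace Ω] (P : Measure Ω)
    (H : Ω → ∀ k, Matrix (Fin (N k)) (Fin M) ℂ) (d : Fin K → ℝ) : Prop :=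
  ∃ (m : ℕ → Fin K → ℕ)
    (V : ∀ n k, Matrix (Fin M × Fin n) (Fin (m n k)) ℂ)
    (Γ : ∀ n k, Fin n → Matrix (Fin (L k)) (Fin (N k)) ℂ),
    (∀ n k t, IsSelectionMatrix (Γ n k t)) ∧
    (∀ n, ∀ᵐ ω ∂P, ∀ k,
      Module.finrank ℂ (projCompl (interferenceSpace (Γ n) (H ω) (V n) k)
        (signalSpace (Γ n) (H ω) (V n) k)) = m n k) ∧
    (∀ k, Tendsto (fun n : ℕ => (m n k : ℝ) / (n : ℝ)) atTop (𝓝 (d k)))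

/-- The LDoF region: the closure of the set of achievable LDoF tuples. -/
def ldofRegion {K M : ℕ} {N : Fin K → ℕ} (L : Fin K → ℕ)
    {Ω : Type*} [MeasurableSpace Ω] (P : Measure Ω)
    (H : Ω → ∀ k, Matrix (Fin (N k)) (Fin M) ℂ) : Set (Fin K → ℝ) :=
  closure {d | IsAchievableLDoF L P H d}

/-- `L_max`, the largest number of RF-chains of a user. -/
def Lmax {K : ℕ} (L : Fin K → ℕ) : ℕ := Finset.univ.sup L

/-!
The converse and the achievability of the LDoF region are both finite-dimensional linear algebra
on top of one probabilistic fact: a polynomial that does not vanish identically is almost surely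
nonzero at independent atomless random variables (`ae_eval_ne_zero`). Hence the rank of
`Γⁿ Hⁿ A` is almost surely the largest rank that any deterministic channel in place of `H` gives
(`ae_forall_rank_extendedChannel_le`). User `k` decodes exactly when every combination of all the
streams that is invisible to it has zero symbols of its own (`finrank_projCompl_eq_iff`).

**Converse.** The core is `exists_rank_extendedChannel_ge`: for every `T × M` matrix `G` and all
selections of `L ≤ T` modes, some channel `H₀` satisfies `rank (Γⁿ H₀ⁿ A) ≥ (L / T) rank (Gⁿ A)`.
Take `H₀ = C U G` with `C` a Vandermonde matrix, so that at each time instant the selected rows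
of `C` span an `L`-dimensional space, and with `U` one of the `T²` unitary Weyl matrices. Averaged
over these unitaries, the orthogonal projection onto any `L`-dimensional space becomes `L / T`
times the identity (`sum_weylMatrix_conj`); so for some `U` the compression of the projections to
the column space of `Gⁿ A` has trace at least `(L / T) rank (Gⁿ A)`, and the trace of such a
compression is at most its rank (`trace_conjTranspose_mul_self_le_rank`). No structure of the
time-varying modes is needed. The interferers are then peeled off in the order of increasing
`T_j = min M N_j` (`exists_rank_maskedBeam_ge`): a receiver with all the modes of user `j` sees
`m_j` dimensions more when the streams of user `j` are added. This shows that the interference at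
user `k` has dimension at least `L_k ∑_{j ≠ k} m_j / T_j`, and it has to fit with the `m_k` streams
of user `k` into `n L_k` dimensions.

**Achievability.** Each user `k` has a clock with `Q` common and `r_k` private values. The slots are
all the tuples of common values and, for each `k` and each choice of common values of the other
clocks (a line), `r_k` slots in which only user `k` is served. Along a line, user `k` receives `r_k`
vectors of `T_k` symbols, in combinations with Vandermonde coefficients. The mode of a user depends
on its own clock only, hence is constant along the lines of the others: what the user sees of
the vectors on another user's line is revealed in the private slots of that line and can be
subtracted in the common slots.
Its own modes run cyclically through `T_k` modes, so `(Q + r_k) L_k ≥ r_k T_k` clean equations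
determine the `r_k T_k` symbols (`ae_decode_single_user`). The resulting tuple is
`d_k = ρ_k T_k / (1 + ∑ ρ_j)` with `ρ_k = r_k / Q ≤ L_k / (T_k - L_k)`. Every tuple of the region
with `∑ d_j / T_j < 1` has this form with real `ρ_k`, which are approximated by rationals, and the
remaining tuples are limits of their multiples by factors below one.
-/

/-! ### Generic rank of the random channel -/

lemma rank_eq_finrank_colSpace {m n : Type*} [Fintype m] [Fintype n] [DecidableEq n]
    (B : Matrix m n ℂ) : B.rank = Module.finrank ℂ (colSpace B) := by
  rw [colSpace, Matrix.toEuclideanLin_eq_toLin_orthonormal]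
  classical
  exact Matrix.rank_eq_finrank_range_toLin B _ _

/-- Some `r` combinations of the columns of a matrix of rank `r` are orthonormal. -/
lemma exists_mul_orthonormal_cols {m n : Type*} [Fintype m] [Fintype n] [DecidableEq n]
    (B : Matrix m n ℂ) {r : ℕ} (hr : B.rank = r) :
    ∃ Q : Matrix n (Fin r) ℂ, (B * Q).conjTranspose * (B * Q) = 1 := by
  have hr' : Module.finrank ℂ (colSpace B) = r := by rw [← rank_eq_finrank_colSpace, hr]
  let b := (stdOrthonormalBasis ℂ (colSpace B)).reindex (finCongr hr')
  have hb : ∀ i, ∃ q : EuclideanSpace ℂ n, Matrix.toEuclideanLin B q = (b i : EuclideanSpace ℂ m) :=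
    fun i => LinearMap.mem_range.1 (b i).2
  choose q hq using hb
  refine ⟨Matrix.of fun j i => q i j, ?_⟩
  have hcol : ∀ a i, (B * Matrix.of fun j i => q i j) a i = (b i : EuclideanSpace ℂ m) a := by
    intro a i
    rw [← hq i]
    simp [Matrix.mul_apply, Matrix.toLpLin_apply, Matrix.mulVec, dotProduct]
  ext i j
  have h := orthonormal_iff_ite.1 b.orthonormal i j
  rw [Matrix.one_apply, ← h, Submodule.coe_inner, PiLp.inner_apply]
  simp only [Matrix.mul_apply, Matrix.conjTranspose_apply] at hcol ⊢
  refine Finset.sum_congr rfl fun a _ => ?_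
  rw [hcol, hcol]
  simp [mul_comm]

/-- The zero set of a nonzero polynomial is a null set of a product of atomless measures. By
induction on the number of variables: where the leading coefficient in the first variable does not
vanish, only the finitely many roots of a polynomial in one variable are left. -/
lemma ae_pi_eval_ne_zero (μ : Measure ℂ) [NullSingletonClass μ] [SigmaFinite μ] :
    ∀ (n : ℕ) (p : MvPolynomial (Fin n) ℂ), p ≠ 0 →
      ∀ᵐ x ∂(Measure.pi fun _ : Fin n => μ), MvPolynomial.eval x p ≠ 0
  | 0, p, hp => by
    refine Eventually.of_forall fun x hx => hp ?_
    rw [MvPolynomial.eq_C_of_isEmpty p] at hx ⊢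
    simpa using hx
  | n + 1, p, hp => by
    have hq : MvPolynomial.finSuccEquiv ℂ n p ≠ 0 := by simpa using hp
    have hlc := ae_pi_eval_ne_zero μ n _ (Polynomial.leadingCoeff_ne_zero.2 hq)
    have hmp := (measurePreserving_piFinSuccAbove (fun _ : Fin (n + 1) => μ) 0).symm
    rw [← hmp.map_eq, ae_map_iff hmp.measurable.aemeasurable]
    swap
    · exact (MvPolynomial.continuous_eval p).measurable (measurableSet_singleton 0).compl
    have hms : MeasurableSet {z : ℂ × (Fin n → ℂ) | MvPolynomial.eval
        ((MeasurableEquiv.piFinSuccAbove (fun _ : Fin (n + 1) => ℂ) 0).symm z) p ≠ 0} :=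
      hmp.measurable
        ((MvPolynomial.continuous_eval p).measurable (measurableSet_singleton 0).compl)
    rw [← Measure.prod_swap, ae_map_iff measurable_swap.aemeasurable hms]
    refine (Measure.ae_prod_iff_ae_ae (measurable_swap hms)).2 ?_
    filter_upwards [hlc] with y hy
    -- the univariate polynomial in the first variable keeps its leading coefficient at `y`
    have hne : (MvPolynomial.finSuccEquiv ℂ n p).map (MvPolynomial.eval y) ≠ 0 := by
      intro h0
      apply hy
      have := congrArg (fun f => f.coeff (MvPolynomial.finSuccEquiv ℂ n p).natDegree) h0
      simpa [Polynomial.coeff_map] using this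
    have hfin : ((((MvPolynomial.finSuccEquiv ℂ n p).map (MvPolynomial.eval y)).roots.toFinset :
      Set ℂ)).Finite := Finset.finite_toSet _
    have hz := hfin.measure_zero μ
    rw [ae_iff]
    refine measure_mono_null (fun x hx => ?_) hz
    simp only [Set.mem_ofPred_eq, not_not, Prod.swap_prod_mk] at hx
    have hxx : MvPolynomial.eval (Fin.cons x y : Fin (n + 1) → ℂ) p = 0 := by
      rw [← hx]
      congr 1
      rw [← Fin.insertNth_zero']
      rfl
    rw [MvPolynomial.eval_eq_eval_mv_eval'] at hxx
    simp [hne, Polynomial.IsRoot, hxx]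

lemma ae_eval_ne_zero {Ω ι : Type*} [MeasurableSpace Ω] [Fintype ι] {P : Measure Ω}
    [IsProbabilityMeasure P] {μ : Measure ℂ} [NullSingletonClass μ] {X : ι → Ω → ℂ}
    (hlaw : ∀ i, HasLaw (X i) μ P) (hindep : iIndepFun X P)
    {p : MvPolynomial ι ℂ} (hp : p ≠ 0) :
    ∀ᵐ ω ∂P, MvPolynomial.eval (fun i => X i ω) p ≠ 0 := by
  rcases isEmpty_or_nonempty ι with hι | ⟨⟨i₀⟩⟩
  · refine Eventually.of_forall fun x hx => hp ?_
    rw [MvPolynomial.eq_C_of_isEmpty p] at hx ⊢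
    simpa using hx
  have : IsProbabilityMeasure μ := by
    rw [← (hlaw i₀).map_eq]
    exact Measure.isProbabilityMeasure_map (hlaw i₀).aemeasurable
  let e := Fintype.equivFin ι
  have hind : iIndepFun (fun j => X (e.symm j)) P := hindep.precomp e.symm.injective
  have hmeas : ∀ j, AEMeasurable (X (e.symm j)) P := fun j => (hlaw _).aemeasurable
  have hmap := hind.map_fun_eq_pi_map hmeas
  simp only [(hlaw _).map_eq] at hmap
  have hren : MvPolynomial.rename e p ≠ 0 := by
    rw [Ne, ← map_zero (MvPolynomial.rename e),
      (MvPolynomial.rename_injective _ e.injective).eq_iff]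
    exact hp
  have h := ae_pi_eval_ne_zero μ _ _ hren
  rw [← hmap] at h
  filter_upwards [ae_of_ae_map (aemeasurable_pi_lambda _ hmeas) h] with ω hω
  simpa [MvPolynomial.eval_rename, Function.comp_def] using hω

/-- Almost surely the random channel gives at least the rank that a fixed channel `H₀` gives: the
determinant `det (S Γⁿ Hⁿ A Q)`, equal to one at `H₀`, is a polynomial in the entries of `H`. -/
lemma ae_rank_extendedChannel_ge {M N L n : ℕ} {c Ω : Type*} [Fintype c] [DecidableEq c]
    [MeasurableSpace Ω] {P : Measure Ω}
    [IsProbabilityMeasure P] {μ : Measure ℂ} [NullSingletonClass μ]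
    {H : Ω → Matrix (Fin N) (Fin M) ℂ}
    (hlaw : ∀ i j, HasLaw (fun ω => H ω i j) μ P)
    (hindep : iIndepFun (fun (p : Fin N × Fin M) (ω : Ω) => H ω p.1 p.2) P)
    (Γ : Fin n → Matrix (Fin L) (Fin N) ℂ) (A : Matrix (Fin M × Fin n) c ℂ)
    (H₀ : Matrix (Fin N) (Fin M) ℂ) :
    ∀ᵐ ω ∂P, (extendedChannel Γ H₀ * A).rank ≤ (extendedChannel Γ (H ω) * A).rank := by
  obtain ⟨r, hr⟩ : ∃ r, (extendedChannel Γ H₀ * A).rank = r := ⟨_, rfl⟩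
  obtain ⟨Q, hQ⟩ := exists_mul_orthonormal_cols (extendedChannel Γ H₀ * A) hr
  set S := (extendedChannel Γ H₀ * A * Q).conjTranspose with hS
  clear_value S
  let X : Matrix (Fin N) (Fin M) (MvPolynomial (Fin N × Fin M) ℂ) :=
    Matrix.of fun i j => MvPolynomial.X (i, j)
  let Aₚ : Matrix (Fin M × Fin n) c (MvPolynomial (Fin N × Fin M) ℂ) := A.map MvPolynomial.C
  let Qₚ : Matrix c (Fin r) (MvPolynomial (Fin N × Fin M) ℂ) :=
    Q.map MvPolynomial.C
  let Sₚ : Matrix (Fin r) (Fin L × Fin n)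
    (MvPolynomial (Fin N × Fin M) ℂ) := S.map MvPolynomial.C
  let Γₚ : Matrix (Fin L × Fin n) (Fin N × Fin n) (MvPolynomial (Fin N × Fin M) ℂ) :=
    (Matrix.blockDiagonal Γ).map MvPolynomial.C
  let B := Sₚ * (Γₚ * Matrix.blockDiagonal (fun _ : Fin n => X) * Aₚ * Qₚ)
  have hev : ∀ G : Matrix (Fin N) (Fin M) ℂ,
      MvPolynomial.eval (fun p => G p.1 p.2) B.det =
        (S * (extendedChannel Γ G * A * Q)).det := by
    intro G
    rw [RingHom.map_det]
    congr 1
    have hX : X.map (MvPolynomial.eval fun p : Fin N × Fin M => G p.1 p.2) = G := by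
      ext i j; simp [X]
    have hS' : Sₚ.map (MvPolynomial.eval fun p : Fin N × Fin M => G p.1 p.2) = S := by
      ext i j; simp [Sₚ]
    have hA' : Aₚ.map (MvPolynomial.eval fun p : Fin N × Fin M => G p.1 p.2) = A := by
      ext i j; simp [Aₚ]
    have hQ' : Qₚ.map (MvPolynomial.eval fun p : Fin N × Fin M => G p.1 p.2) = Q := by
      ext i j; simp [Qₚ]
    have hΓ' : Γₚ.map (MvPolynomial.eval fun p : Fin N × Fin M => G p.1 p.2) =
        Matrix.blockDiagonal Γ := by
      ext i j; simp [Γₚ]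
    rw [RingHom.mapMatrix_apply]
    simp only [B, Matrix.map_mul, extendedChannel, hS', hA', hQ', hΓ']
    rw [Matrix.blockDiagonal_map _ _ (map_zero _)]
    simp only [hX]
  have hB : B.det ≠ 0 := by
    intro h
    have := hev H₀
    rw [h, hQ] at this
    simp at this
  filter_upwards [ae_eval_ne_zero (fun p => hlaw p.1 p.2) hindep hB] with ω hω
  rw [hev (H ω)] at hω
  calc _ = _ := by rw [hr, Matrix.rank_of_det_ne_zero hω, Fintype.card_fin]
    _ ≤ _ := Matrix.rank_mul_le_right _ _
    _ ≤ _ := Matrix.rank_mul_le_left _ _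

/-! ### Comparing ranks under time-varying mode selection -/

/-- The Weyl (clock-and-shift) unitary `e_j ↦ ζ^(b j) e_(j+a)` with `ζ = exp (2πi / T)`. -/
noncomputable def weylMatrix {T : ℕ} [NeZero T] (a b : Fin T) : Matrix (Fin T) (Fin T) ℂ :=
  Matrix.of fun i j =>
    if i = j + a then (Complex.exp (2 * Real.pi * Complex.I / T)) ^ ((b : ℕ) * (j : ℕ)) else 0

lemma star_rootOfUnity_mul_self (T : ℕ) :
    star (Complex.exp (2 * Real.pi * Complex.I / T)) *
      Complex.exp (2 * Real.pi * Complex.I / T) = 1 := by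
  have h : (2 * Real.pi * Complex.I / T : ℂ) = ((2 * Real.pi / T : ℝ) : ℂ) * Complex.I := by
    push_cast; ring
  have h1 := Complex.norm_exp_ofReal_mul_I (2 * Real.pi / T)
  rw [h, Complex.star_def, ← Complex.normSq_eq_conj_mul_self, Complex.normSq_eq_norm_sq, h1]
  simp

lemma weylMatrix_mul_conjTranspose {T : ℕ} [NeZero T] (a b : Fin T) :
    weylMatrix a b * (weylMatrix a b).conjTranspose = 1 := by
  ext i j
  rw [Matrix.mul_apply, Finset.sum_eq_single (i - a)]
  · simp only [weylMatrix, Matrix.of_apply, Matrix.conjTranspose_apply, sub_add_cancel, if_true,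
      Matrix.one_apply]
    by_cases h : i = j
    · subst h
      simp only [if_true, star_pow, ← mul_pow]
      rw [mul_comm (Complex.exp _), star_rootOfUnity_mul_self, one_pow]
    · simp [h, Ne.symm h]
  · intro k _ hk
    have : i ≠ k + a := fun h => hk (by rw [h]; simp)
    simp [weylMatrix, this]
  · simp

/-- Orthogonality of the characters of the cyclic group of order `T`. -/
lemma sum_star_pow_mul_pow {T : ℕ} [NeZero T] (i j : Fin T) :
    ∑ b : Fin T, star ((Complex.exp (2 * Real.pi * Complex.I / T)) ^ ((b : ℕ) * (i : ℕ))) *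
      (Complex.exp (2 * Real.pi * Complex.I / T)) ^ ((b : ℕ) * (j : ℕ)) =
      if i = j then (T : ℂ) else 0 := by
  have hprim := Complex.isPrimitiveRoot_exp T (NeZero.ne T)
  have hstar := star_rootOfUnity_mul_self T
  set ζ := Complex.exp (2 * Real.pi * Complex.I / T)
  have hterm : ∀ b : Fin T, star (ζ ^ ((b : ℕ) * (i : ℕ))) * ζ ^ ((b : ℕ) * (j : ℕ)) =
      (star ζ ^ (i : ℕ) * ζ ^ (j : ℕ)) ^ (b : ℕ) := by
    intro b
    rw [star_pow, mul_pow, ← pow_mul, ← pow_mul, mul_comm (b : ℕ), mul_comm (b : ℕ)]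
  simp only [hterm]
  rw [Fin.sum_univ_eq_sum_range (fun b => (star ζ ^ (i : ℕ) * ζ ^ (j : ℕ)) ^ b)]
  split_ifs with h
  · subst h
    simp only [← mul_pow, hstar, one_pow, Finset.sum_const,
      Finset.card_range, nsmul_eq_mul, mul_one]
  · set w := star ζ ^ (i : ℕ) * ζ ^ (j : ℕ) with hw
    have hw1 : w ≠ 1 := by
      intro h1
      apply h
      have : ζ ^ (j : ℕ) = ζ ^ (i : ℕ) := by
        have h2 : ζ ^ (i : ℕ) * w = ζ ^ (j : ℕ) := by
          rw [hw, ← mul_assoc, ← mul_pow, mul_comm ζ, hstar, one_pow, one_mul]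
        rw [← h2, h1, mul_one]
      exact Fin.ext (hprim.pow_inj i.2 j.2 this.symm)
    have hwT : w ^ T = 1 := by
      rw [hw, mul_pow, ← pow_mul, ← pow_mul, mul_comm (i : ℕ), mul_comm (j : ℕ), pow_mul, pow_mul,
        ← star_pow, hprim.pow_eq_one]
      simp
    have := geom_sum_mul w T
    rw [hwT, sub_self] at this
    exact (mul_eq_zero.1 this).resolve_right (sub_ne_zero.2 hw1)

/-- Twirling by the Weyl unitaries turns every matrix into a multiple of the identity. -/
lemma sum_weylMatrix_conj {T : ℕ} [NeZero T] (P : Matrix (Fin T) (Fin T) ℂ) :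
    ∑ g : Fin T × Fin T, (weylMatrix g.1 g.2).conjTranspose * P * weylMatrix g.1 g.2 =
      (T * P.trace) • (1 : Matrix (Fin T) (Fin T) ℂ) := by
  have hent : ∀ (a b i j : Fin T),
      ((weylMatrix a b).conjTranspose * P * weylMatrix a b) i j = P (i + a) (j + a) *
      (star ((Complex.exp (2 * Real.pi * Complex.I / T)) ^ ((b : ℕ) * (i : ℕ))) *
      (Complex.exp (2 * Real.pi * Complex.I / T)) ^ ((b : ℕ) * (j : ℕ))) := by
    intro a b i j
    rw [Matrix.mul_apply, Finset.sum_eq_single (j + a), Matrix.mul_apply,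
      Finset.sum_eq_single (i + a)]
    · simp only [weylMatrix, Matrix.of_apply, Matrix.conjTranspose_apply, if_true]
      ring
    · intro k _ hk
      simp [weylMatrix, hk]
    · simp
    · intro k _ hk
      simp [weylMatrix, hk]
    · simp
  ext i j
  rw [Matrix.sum_apply, Fintype.sum_prod_type]
  simp only [hent, ← Finset.mul_sum, sum_star_pow_mul_pow]
  rw [← Finset.sum_mul, Matrix.smul_apply, Matrix.one_apply]
  split_ifs with h
  · subst h
    rw [Matrix.trace, smul_eq_mul, mul_one, mul_comm]
    congr 1
    exact Fintype.sum_equiv (Equiv.addLeft i) _ _ (fun a => rfl)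
  · simp

open scoped ComplexOrder in
/-- A product of a co-isometry and an isometry is a contraction, so the eigenvalues of its Gram
matrix lie in `[0, 1]` and their sum is at most the number of the nonzero ones. -/
lemma trace_conjTranspose_mul_self_le_rank {l m n : Type*} [Fintype l] [Fintype m] [Fintype n]
    [DecidableEq l] [DecidableEq m] [DecidableEq n] {X : Matrix l m ℂ} {Y : Matrix m n ℂ}
    (hX : X * X.conjTranspose = 1) (hY : Y.conjTranspose * Y = 1) :
    ((X * Y).conjTranspose * (X * Y)).trace.re ≤ ((X * Y).rank : ℝ) := by
  set Z := X * Y with hZ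
  have hpsd := Matrix.posSemidef_conjTranspose_mul_self Z
  have hherm := hpsd.isHermitian
  have hdiff : (1 - Z.conjTranspose * Z).PosSemidef := by
    have : 1 - Z.conjTranspose * Z =
        ((1 - X.conjTranspose * X) * Y).conjTranspose * ((1 - X.conjTranspose * X) * Y) := by
      have h1 : (1 - X.conjTranspose * X) * (1 - X.conjTranspose * X) =
          1 - X.conjTranspose * X := by
        have : X.conjTranspose * X * (X.conjTranspose * X) = X.conjTranspose * X := by
          rw [Matrix.mul_assoc, ← Matrix.mul_assoc X, hX, Matrix.one_mul]
        rw [sub_mul, mul_sub, mul_sub, this]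
        simp
      have h2 : (1 - X.conjTranspose * X).conjTranspose = 1 - X.conjTranspose * X := by
        simp [Matrix.conjTranspose_mul]
      rw [Matrix.conjTranspose_mul (1 - X.conjTranspose * X) Y, h2, Matrix.mul_assoc,
        ← Matrix.mul_assoc (1 - X.conjTranspose * X) (1 - X.conjTranspose * X) Y, h1,
        Matrix.sub_mul, Matrix.mul_sub, Matrix.one_mul, hY, Matrix.mul_assoc X.conjTranspose,
        ← Matrix.mul_assoc Y.conjTranspose, ← Matrix.conjTranspose_mul]
    rw [this]
    exact Matrix.posSemidef_conjTranspose_mul_self _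
  have hle : ∀ i, hherm.eigenvalues i ≤ 1 := by
    intro i
    have h := hdiff.re_dotProduct_nonneg (⇑(hherm.eigenvectorBasis i))
    have hn : (star (⇑(hherm.eigenvectorBasis i)) ⬝ᵥ (⇑(hherm.eigenvectorBasis i))) = 1 := by
      have := orthonormal_iff_ite.1 hherm.eigenvectorBasis.orthonormal i i
      rw [if_pos rfl, EuclideanSpace.inner_eq_star_dotProduct, dotProduct_comm] at this
      exact this
    rw [Matrix.sub_mulVec, Matrix.one_mulVec, dotProduct_sub, map_sub, hn,
      hherm.mulVec_eigenvectorBasis, dotProduct_smul, hn] at h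
    simp at h
    linarith
  have htr : (Z.conjTranspose * Z).trace.re = ∑ i, hherm.eigenvalues i := by
    rw [hherm.trace_eq_sum_eigenvalues]
    simp
  rw [htr, ← Matrix.rank_conjTranspose_mul_self, hherm.rank_eq_card_non_zero_eigs,
    Fintype.card_subtype, Finset.card_eq_sum_ones, Finset.sum_filter]
  push_cast
  refine Finset.sum_le_sum fun i _ => ?_
  split_ifs with h
  · exact hle i
  · push Not at h
    exact h.le

open scoped ComplexOrder in
lemma exists_mul_orthonormal_rows {L T : ℕ} {C : Matrix (Fin L) (Fin T) ℂ} (hC : C.rank = L) :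
    ∃ B : Matrix (Fin L) (Fin L) ℂ, (B * C) * (B * C).conjTranspose = 1 := by
  obtain ⟨Q, hQ⟩ := exists_mul_orthonormal_cols C.conjTranspose
    (by rw [Matrix.rank_conjTranspose, hC] : C.conjTranspose.rank = L)
  refine ⟨Q.conjTranspose, ?_⟩
  simpa [Matrix.conjTranspose_mul] using hQ

/-- Any `L ≤ T` rows of a Vandermonde matrix with `T` columns are linearly independent. -/
lemma rank_vandermonde_rows {N L T : ℕ} (hLT : L ≤ T) {s : Fin L → Fin N}
    (hs : Function.Injective s) :
    (Matrix.of fun (l : Fin L) (j : Fin T) => ((s l : ℕ) : ℂ) ^ (j : ℕ)).rank = L := by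
  refine le_antisymm (Matrix.rank_le_height _) ?_
  have hdet : (Matrix.vandermonde fun l : Fin L => ((s l : ℕ) : ℂ)).det ≠ 0 := by
    rw [Matrix.det_vandermonde_ne_zero_iff]
    intro a b h
    exact hs (Fin.ext (Nat.cast_injective (R := ℂ) h))
  have h := Matrix.rank_of_det_ne_zero hdet
  rw [Fintype.card_fin] at h
  calc L = _ := h.symm
    _ = ((Matrix.of fun (l : Fin L) (j : Fin T) => ((s l : ℕ) : ℂ) ^ (j : ℕ)).submatrix id
        (Fin.castLE hLT)).rank := rfl
    _ ≤ _ := Matrix.rank_submatrix_le _ _ _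

/-- Observing `L` selected modes, possibly different ones at different times, of a suitable channel
retains at least the fraction `L / T` of the rank that the constant channel `G` with `T` outputs
has. -/
lemma exists_rank_extendedChannel_ge {M N L n T : ℕ} {c : Type*} [Fintype c] [DecidableEq c]
    (hT : 1 ≤ T) (hLT : L ≤ T) (Γ : Fin n → Matrix (Fin L) (Fin N) ℂ)
    (hΓ : ∀ t, IsSelectionMatrix (Γ t)) (G : Matrix (Fin T) (Fin M) ℂ)
    (A : Matrix (Fin M × Fin n) c ℂ) :
    ∃ H₀ : Matrix (Fin N) (Fin M) ℂ,
      L * (Matrix.blockDiagonal (fun _ : Fin n => G) * A).rank ≤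
        T * (extendedChannel Γ H₀ * A).rank := by
  have : NeZero T := ⟨by omega⟩
  obtain ⟨w, hw⟩ : ∃ w, (Matrix.blockDiagonal (fun _ : Fin n => G) * A).rank = w := ⟨_, rfl⟩
  obtain ⟨Q, hQ⟩ := exists_mul_orthonormal_cols _ hw
  set Y := Matrix.blockDiagonal (fun _ : Fin n => G) * A * Q with hYdef
  let C : Matrix (Fin N) (Fin T) ℂ := Matrix.of fun i j => ((i : ℕ) : ℂ) ^ (j : ℕ)
  have hB : ∀ t, ∃ B : Matrix (Fin L) (Fin L) ℂ,
      (B * (Γ t * C)) * (B * (Γ t * C)).conjTranspose = 1 := by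
    intro t
    apply exists_mul_orthonormal_rows
    obtain ⟨hsel, hinj⟩ := hΓ t
    choose s hs using hsel
    have hsinj : Function.Injective s := fun a b hab => hinj (by rw [hs, hs, hab])
    refine Eq.trans (congrArg Matrix.rank ?_) (rank_vandermonde_rows hLT hsinj)
    ext l j
    simp [Matrix.mul_apply, hs, Pi.single_apply, C]
  choose B hB using hB
  let F : Fin n → Matrix (Fin L) (Fin T) ℂ := fun t => B t * (Γ t * C)
  let U : Fin T × Fin T → Matrix (Fin T) (Fin T) ℂ := fun g => weylMatrix g.1 g.2
  let X : Fin T × Fin T → Matrix (Fin L × Fin n) (Fin T × Fin n) ℂ :=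
    fun g => Matrix.blockDiagonal fun t => F t * U g
  have hX : ∀ g, X g * (X g).conjTranspose = 1 := by
    intro g
    simp only [X]
    rw [Matrix.blockDiagonal_conjTranspose, ← Matrix.blockDiagonal_mul, ← Matrix.blockDiagonal_one]
    congr 1
    ext1 t
    rw [Matrix.conjTranspose_mul, Matrix.mul_assoc, ← Matrix.mul_assoc (U g),
      weylMatrix_mul_conjTranspose, Matrix.one_mul]
    exact hB t
  have hXX : ∑ g, (X g).conjTranspose * X g = ((T * L : ℕ) : ℂ) • 1 := by
    have h1 : ∀ g, (X g).conjTranspose * X g = Matrix.blockDiagonal fun t =>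
        (U g).conjTranspose * ((F t).conjTranspose * F t) * U g := by
      intro g
      simp only [X]
      rw [Matrix.blockDiagonal_conjTranspose, ← Matrix.blockDiagonal_mul]
      simp only [Matrix.conjTranspose_mul, Matrix.mul_assoc]
    have h2 : ∀ t, ∑ g, (U g).conjTranspose * ((F t).conjTranspose * F t) * U g =
        ((T * L : ℕ) : ℂ) • (1 : Matrix (Fin T) (Fin T) ℂ) := by
      intro t
      rw [sum_weylMatrix_conj, Matrix.trace_mul_comm, hB t]
      simp
    ext ⟨i, t⟩ ⟨j, t'⟩
    rw [Matrix.sum_apply]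
    simp only [h1, Matrix.blockDiagonal_apply]
    by_cases h : t = t'
    · subst h
      have := congrFun (congrFun (h2 t) i) j
      rw [Matrix.sum_apply] at this
      simpa [Matrix.one_apply] using this
    · simp [h]
  have hsum : ∑ g, ((X g * Y).conjTranspose * (X g * Y)).trace.re = (T * L * w : ℕ) := by
    have h1 : ∑ g, ((X g * Y).conjTranspose * (X g * Y)) = ((T * L : ℕ) : ℂ) • 1 := by
      have : ∀ g, (X g * Y).conjTranspose * (X g * Y) =
          Y.conjTranspose * ((X g).conjTranspose * X g) * Y := by
        intro g; simp only [Matrix.conjTranspose_mul, Matrix.mul_assoc]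
      simp only [this]
      rw [← Matrix.sum_mul, ← Matrix.mul_sum, hXX]
      simp [hQ]
    rw [← Complex.re_sum, ← Matrix.trace_sum, h1]
    simp [← Nat.cast_mul, Complex.natCast_re]
  -- some unitary does at least as well as the average over all `T ^ 2` of them
  obtain ⟨g, hg⟩ : ∃ g, L * w ≤ T * (X g * Y).rank := by
    by_contra! hcon
    have h1 : ∀ g, (T : ℝ) * ((X g * Y).conjTranspose * (X g * Y)).trace.re < L * w := by
      intro g
      have h2 : ((T * (X g * Y).rank : ℕ) : ℝ) < ((L * w : ℕ) : ℝ) := by exact_mod_cast hcon g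
      push_cast at h2
      refine lt_of_le_of_lt ?_ h2
      gcongr
      exact trace_conjTranspose_mul_self_le_rank (hX g) hQ
    have h3 := Finset.sum_lt_sum_of_nonempty (s := (Finset.univ : Finset (Fin T × Fin T)))
      Finset.univ_nonempty (fun g _ => h1 g)
    rw [← Finset.mul_sum, hsum] at h3
    simp at h3
    nlinarith
  -- `B` orthonormalises the selected rows of `C`, and multiplying by it cannot raise the rank
  refine ⟨C * U g * G, ?_⟩
  rw [hw]
  refine hg.trans (Nat.mul_le_mul_left _ ?_)
  have : X g * Y = Matrix.blockDiagonal B * (extendedChannel Γ (C * U g * G) * A) * Q := by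
    simp only [hYdef, X, F, extendedChannel]
    rw [← Matrix.blockDiagonal_mul]
    simp only [← Matrix.mul_assoc]
    rw [← Matrix.blockDiagonal_mul, ← Matrix.blockDiagonal_mul]
    simp only [Matrix.mul_assoc]
  rw [this]
  exact (Matrix.rank_mul_le_left _ _).trans (Matrix.rank_mul_le_right _ _)

/-! ### The outer bound -/

lemma finrank_projCompl_colSpace_eq_card_iff {r b : Type*} [Fintype r] [Fintype b] [DecidableEq b]
    {m : ℕ} (A : Matrix r (Fin m) ℂ) (B : Matrix r b ℂ) :
    Module.finrank ℂ (projCompl (colSpace B) (colSpace A)) = m ↔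
      ∀ v w, A.mulVec v + B.mulVec w = 0 → v = 0 := by
  have hmap : projCompl (colSpace B) (colSpace A) = LinearMap.range
      ((colSpace B)ᗮ.starProjection.toLinearMap ∘ₗ Matrix.toEuclideanLin A) := by
    rw [projCompl, colSpace, colSpace, LinearMap.range_comp]
  set f := (colSpace B)ᗮ.starProjection.toLinearMap ∘ₗ Matrix.toEuclideanLin A with hf
  have hrn := f.finrank_range_add_finrank_ker
  rw [finrank_euclideanSpace_fin] at hrn
  have hker : LinearMap.ker f = ⊥ ↔ Module.finrank ℂ (LinearMap.range f) = m := by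
    rw [← Submodule.finrank_eq_zero]
    omega
  rw [hmap, ← hker, LinearMap.ker_eq_bot']
  have hzero : ∀ v : EuclideanSpace ℂ (Fin m),
      f v = 0 ↔ ∃ w : b → ℂ, A.mulVec v.ofLp + B.mulVec w = 0 := by
    intro v
    have h1 : f v = 0 ↔ Matrix.toEuclideanLin A v ∈ colSpace B := by
      have : f v = (colSpace B)ᗮ.starProjection (Matrix.toEuclideanLin A v) := rfl
      rw [this, Submodule.starProjection_apply_eq_zero_iff, Submodule.orthogonal_orthogonal]
    rw [h1, colSpace, LinearMap.mem_range]
    constructor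
    · rintro ⟨w, hw⟩
      refine ⟨-w.ofLp, ?_⟩
      have := congrArg WithLp.ofLp hw
      simp only [Matrix.ofLp_toLpLin, Matrix.toLin'_apply] at this
      rw [Matrix.mulVec_neg, this, add_neg_cancel]
    · rintro ⟨w, hw⟩
      refine ⟨WithLp.toLp 2 (-w), ?_⟩
      apply WithLp.ofLp_injective
      simp only [Matrix.ofLp_toLpLin, Matrix.toLin'_apply]
      rw [Matrix.mulVec_neg, eq_comm, ← add_eq_zero_iff_eq_neg, hw]
  constructor
  · intro h v w hvw
    have := h (WithLp.toLp 2 v) ((hzero _).2 ⟨w, hvw⟩)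
    simpa using congrArg WithLp.ofLp this
  · intro h v hv
    obtain ⟨w, hw⟩ := (hzero v).1 hv
    exact WithLp.ofLp_injective 2 (h _ w hw)

/-- Decodability of user `k` without projections: if the sum of all transmitted signals is received
by user `k` as zero, then the symbols of user `k` are zero. -/
lemma finrank_projCompl_eq_iff {K M n : ℕ} {N L m : Fin K → ℕ}
    (Γ : ∀ k, Fin n → Matrix (Fin (L k)) (Fin (N k)) ℂ)
    (H : ∀ k, Matrix (Fin (N k)) (Fin M) ℂ)
    (V : ∀ k, Matrix (Fin M × Fin n) (Fin (m k)) ℂ) (k : Fin K) :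
    Module.finrank ℂ (projCompl (interferenceSpace Γ H V k) (signalSpace Γ H V k)) = m k ↔
      ∀ x : ∀ j, Fin (m j) → ℂ,
        (extendedChannel (Γ k) (H k)).mulVec (∑ j, (V j).mulVec (x j)) = 0 → x k = 0 := by
  rw [interferenceSpace, signalSpace, finrank_projCompl_colSpace_eq_card_iff]
  have hoth : ∀ w : (Σ j : {j : Fin K // j ≠ k}, Fin (m j)) → ℂ,
      (othersBeam V k).mulVec w =
        ∑ j : {j : Fin K // j ≠ k}, (V j).mulVec (fun i => w ⟨j, i⟩) := by
    intro w
    ext i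
    simp [Matrix.mulVec, dotProduct, othersBeam, Fintype.sum_sigma, Finset.sum_apply]
  have hsplit : ∀ x : ∀ j, Fin (m j) → ℂ, ∑ j, (V j).mulVec (x j) = (V k).mulVec (x k) +
      ∑ j : {j : Fin K // j ≠ k}, (V j).mulVec (x j) := fun x =>
    Fintype.sum_eq_add_sum_subtype_ne (fun j => (V j).mulVec (x j)) k
  constructor
  · intro h x hx
    refine h (x k) (fun p => x p.1 p.2) ?_
    rw [← Matrix.mulVec_mulVec, ← Matrix.mulVec_mulVec, ← Matrix.mulVec_add, hoth, ← hx, hsplit]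
  · intro h v w hvw
    let x : ∀ j, Fin (m j) → ℂ := fun j =>
      if hj : j = k then hj ▸ v else fun i => w ⟨⟨j, hj⟩, i⟩
    have hxk : x k = v := by simp [x]
    rw [← hxk]
    apply h
    rw [hsplit, hxk, ← hvw, ← Matrix.mulVec_mulVec, ← Matrix.mulVec_mulVec, ← Matrix.mulVec_add,
      hoth]
    congr 2
    refine Finset.sum_congr rfl fun j _ => ?_
    congr 1
    ext i
    simp [x, j.2]

/-- The juxtaposition `[V_1 ⋯ V_K]` in which the columns of the users outside `S` are replaced by
zero. Keeping the zero columns gives one column type for all `S`. -/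
def maskedBeam {K : ℕ} {r : Type*} {m : Fin K → ℕ} (V : ∀ k, Matrix r (Fin (m k)) ℂ)
    (S : Finset (Fin K)) : Matrix r (Σ j : Fin K, Fin (m j)) ℂ :=
  Matrix.of fun i p => if p.1 ∈ S then V p.1 i p.2 else 0

lemma maskedBeam_mulVec {K : ℕ} {r : Type*} {m : Fin K → ℕ}
    (V : ∀ k, Matrix r (Fin (m k)) ℂ) (S : Finset (Fin K)) (w : (Σ j : Fin K, Fin (m j)) → ℂ) :
    (maskedBeam V S).mulVec w =
      ∑ j, (V j).mulVec (if j ∈ S then fun i => w ⟨j, i⟩ else 0) := by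
  ext i
  simp only [Matrix.mulVec, dotProduct, maskedBeam, Fintype.sum_sigma, Finset.sum_apply,
    Matrix.of_apply]
  refine Finset.sum_congr rfl fun j _ => Finset.sum_congr rfl fun l _ => ?_
  split_ifs <;> simp

/-- A receiver that can decode user `j` sees `m j` new dimensions when the streams of user `j` are
added. -/
lemma rank_maskedBeam_erase_add_le {K : ℕ} {r s : Type*} [Fintype r] [Fintype s]
    {m : Fin K → ℕ} (V : ∀ k, Matrix r (Fin (m k)) ℂ) (X : Matrix s r ℂ) {S : Finset (Fin K)}
    {j : Fin K} (hj : j ∈ S)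
    (hdec : ∀ x : ∀ i, Fin (m i) → ℂ, X.mulVec (∑ i, (V i).mulVec (x i)) = 0 → x j = 0) :
    m j + (X * maskedBeam V (S.erase j)).rank ≤ (X * maskedBeam V S).rank := by
  have hsingle : ∀ v : Fin (m j) → ℂ,
      ∑ i, (V i).mulVec ((Pi.single j v : ∀ i, Fin (m i) → ℂ) i) = (V j).mulVec v := by
    intro v
    rw [Finset.sum_eq_single j]
    · simp
    · intro i _ hi
      simp [Pi.single_eq_of_ne hi]
    · simp
  have hdec' : ∀ v w, X.mulVec ((V j).mulVec v) =
      X.mulVec ((maskedBeam V (S.erase j)).mulVec w) → v = 0 := by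
    intro v w h
    have := hdec (Pi.single j v -
      fun i => if i ∈ S.erase j then fun l => w ⟨i, l⟩ else 0) (by
      simp only [Pi.sub_apply, Matrix.mulVec_sub, Finset.sum_sub_distrib]
      rw [hsingle, ← maskedBeam_mulVec, h, sub_self])
    simpa using this
  set R₁ := LinearMap.range (X * V j).mulVecLin
  set R₂ := LinearMap.range (X * maskedBeam V (S.erase j)).mulVecLin
  have hinj : Function.Injective (X * V j).mulVecLin := by
    rw [← LinearMap.ker_eq_bot, LinearMap.ker_eq_bot']
    intro v hv
    rw [Matrix.mulVecLin_apply, ← Matrix.mulVec_mulVec] at hv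
    exact hdec' v 0 (by rw [hv]; simp)
  have h1 : Module.finrank ℂ R₁ = m j := by
    rw [LinearMap.finrank_range_of_inj hinj]; simp
  have h2 : R₁ ⊓ R₂ = ⊥ := by
    rw [eq_bot_iff]
    rintro y ⟨⟨v, hv⟩, ⟨w, hw⟩⟩
    rw [Matrix.mulVecLin_apply, ← Matrix.mulVec_mulVec] at hv hw
    have := hdec' v w (hv.trans hw.symm)
    rw [this] at hv
    simpa using hv.symm
  have h3 : R₁ ⊔ R₂ ≤ LinearMap.range (X * maskedBeam V S).mulVecLin := by
    rw [sup_le_iff]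
    constructor
    · rintro y ⟨v, rfl⟩
      refine ⟨fun p => (Pi.single j v : ∀ i, Fin (m i) → ℂ) p.1 p.2, ?_⟩
      rw [Matrix.mulVecLin_apply, Matrix.mulVecLin_apply, ← Matrix.mulVec_mulVec,
        ← Matrix.mulVec_mulVec, maskedBeam_mulVec, ← hsingle v]
      congr 1
      refine Finset.sum_congr rfl fun i _ => ?_
      congr 1
      by_cases hi : i = j
      · subst hi; simp [hj]
      · simp only [Pi.single_eq_of_ne hi]
        split_ifs <;> rfl
    · rintro y ⟨w, rfl⟩
      refine ⟨fun p => if p.1 ∈ S.erase j then w p else 0, ?_⟩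
      rw [Matrix.mulVecLin_apply, Matrix.mulVecLin_apply, ← Matrix.mulVec_mulVec,
        ← Matrix.mulVec_mulVec, maskedBeam_mulVec, maskedBeam_mulVec]
      congr 1
      refine Finset.sum_congr rfl fun i _ => ?_
      congr 1
      ext l
      by_cases hi : i = j
      · subst hi; simp [hj]
      · by_cases hS : i ∈ S <;> simp [hi, hS]
  have h4 := Submodule.finrank_sup_add_finrank_inf_eq R₁ R₂
  rw [h2, finrank_bot, h1, add_zero] at h4
  have h5 := Submodule.finrank_mono h3
  rw [h4] at h5
  exact h5

lemma extendedChannel_one {M N n : ℕ} (H : Matrix (Fin N) (Fin M) ℂ) :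
    extendedChannel (fun _ : Fin n => (1 : Matrix (Fin N) (Fin N) ℂ)) H =
      Matrix.blockDiagonal (fun _ : Fin n => H) := by
  rw [extendedChannel, ← Matrix.blockDiagonal_mul]
  simp

lemma isSelectionMatrix_one (N : ℕ) : IsSelectionMatrix (1 : Matrix (Fin N) (Fin N) ℂ) := by
  refine ⟨fun l => ⟨l, by
    ext i
    simp [Matrix.one_apply, Pi.single_apply, eq_comm]⟩, fun a b h => ?_⟩
  by_contra hab
  have := congrFun h a
  simp [Ne.symm hab] at this

/-- The dimension of interference. Each user `j` is represented by a generic matrix `G j` with `T j`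
outputs from which it can decode; the induction removes the user with the smallest `T j`, for which
the rank comparison `exists_rank_extendedChannel_ge` goes in the right direction. -/
lemma exists_rank_maskedBeam_ge {K M n : ℕ} {m : Fin K → ℕ}
    (V : ∀ k, Matrix (Fin M × Fin n) (Fin (m k)) ℂ) {T : Fin K → ℕ} (hT : ∀ j, 1 ≤ T j)
    (G : ∀ j, Matrix (Fin (T j)) (Fin M) ℂ)
    (hdec : ∀ j (x : ∀ i, Fin (m i) → ℂ),
      (Matrix.blockDiagonal fun _ : Fin n => G j).mulVec (∑ i, (V i).mulVec (x i)) = 0 → x j = 0)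
    (hgen : ∀ j (S : Finset (Fin K)) (G₀ : Matrix (Fin (T j)) (Fin M) ℂ),
      ((Matrix.blockDiagonal fun _ : Fin n => G₀) * maskedBeam V S).rank ≤
        ((Matrix.blockDiagonal fun _ : Fin n => G j) * maskedBeam V S).rank)
    (S : Finset (Fin K)) :
    ∀ {N L : ℕ} (Γ : Fin n → Matrix (Fin L) (Fin N) ℂ), (∀ t, IsSelectionMatrix (Γ t)) →
      (∀ j ∈ S, L ≤ T j) → ∃ H₀ : Matrix (Fin N) (Fin M) ℂ,
        (L : ℝ) * ∑ j ∈ S, (m j : ℝ) / T j ≤ (extendedChannel Γ H₀ * maskedBeam V S).rank := by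
  induction S using Finset.strongInduction with
  | H S ih =>
    intro N L Γ hΓ hL
    rcases S.eq_empty_or_nonempty with rfl | hne
    · exact ⟨0, by simp⟩
    obtain ⟨j, hj, hmin⟩ := S.exists_min_image T hne
    obtain ⟨G₀, hG₀⟩ := ih (S.erase j) (Finset.erase_ssubset hj)
      (fun _ : Fin n => (1 : Matrix (Fin (T j)) (Fin (T j)) ℂ)) (fun _ => isSelectionMatrix_one _)
      (fun i hi => hmin i (Finset.mem_of_mem_erase hi))
    rw [extendedChannel_one] at hG₀
    have h1 := rank_maskedBeam_erase_add_le V _ hj (hdec j)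
    have h2 := hgen j (S.erase j) G₀
    obtain ⟨H₀, hH₀⟩ := exists_rank_extendedChannel_ge (hT j) (hL j hj) Γ hΓ (G j) (maskedBeam V S)
    refine ⟨H₀, ?_⟩
    rw [← Finset.add_sum_erase S _ hj]
    set σ := ∑ i ∈ S.erase j, (m i : ℝ) / T i
    have hTj : (0 : ℝ) < T j := by exact_mod_cast hT j
    have h3 : (m j : ℝ) + T j * σ ≤
        (((Matrix.blockDiagonal fun _ : Fin n => G j) * maskedBeam V S).rank : ℝ) := by
      refine le_trans ?_ (Nat.cast_le.2 h1)
      push_cast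
      have : ((((Matrix.blockDiagonal fun _ : Fin n => G₀) *
        maskedBeam V (S.erase j)).rank : ℕ) : ℝ) ≤ _ := Nat.cast_le.2 h2
      linarith
    have h4 : (L : ℝ) * (((Matrix.blockDiagonal fun _ : Fin n => G j) * maskedBeam V S).rank : ℝ) ≤
        T j * ((extendedChannel Γ H₀ * maskedBeam V S).rank : ℝ) := by exact_mod_cast hH₀
    have h5 : (T j : ℝ) * (L * ((m j : ℝ) / T j + σ)) = L * (m j + T j * σ) := by
      field_simp
    refine le_of_mul_le_mul_left ?_ hTj
    rw [h5]
    exact (mul_le_mul_of_nonneg_left h3 (Nat.cast_nonneg L)).trans h4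

/-- The channel of a user factors through a matrix with `min M N` rows that is still of largest
possible rank: the channel itself if `N ≤ M`, the identity otherwise. -/
lemma exists_generic_factor {M N n : ℕ} {ι c : Type*} [Fintype c]
    (A : ι → Matrix (Fin M × Fin n) c ℂ)
    (H : Matrix (Fin N) (Fin M) ℂ)
    (hgen : ∀ i (H₀ : Matrix (Fin N) (Fin M) ℂ),
      ((Matrix.blockDiagonal fun _ : Fin n => H₀) * A i).rank ≤
        ((Matrix.blockDiagonal fun _ : Fin n => H) * A i).rank) :
    ∃ G : Matrix (Fin (min M N)) (Fin M) ℂ, (∃ D : Matrix (Fin N) (Fin (min M N)) ℂ, H = D * G) ∧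
      ∀ i (G₀ : Matrix (Fin (min M N)) (Fin M) ℂ),
      ((Matrix.blockDiagonal fun _ : Fin n => G₀) * A i).rank ≤
        ((Matrix.blockDiagonal fun _ : Fin n => G) * A i).rank := by
  rcases le_total N M with h | h
  · rw [min_eq_right h]
    exact ⟨H, ⟨1, by simp⟩, hgen⟩
  · rw [min_eq_left h]
    refine ⟨1, ⟨H, by simp⟩, fun i G₀ => ?_⟩
    have : (Matrix.blockDiagonal fun _ : Fin n => (1 : Matrix (Fin M) (Fin M) ℂ)) = 1 :=
      Matrix.blockDiagonal_one
    rw [this, Matrix.one_mul]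
    exact Matrix.rank_mul_le_right _ _

lemma ae_forall_rank_extendedChannel_le {M N L n : ℕ} {c Ω : Type*} [Fintype c] [DecidableEq c]
    [MeasurableSpace Ω] {P : Measure Ω}
    [IsProbabilityMeasure P] {μ : Measure ℂ} [NullSingletonClass μ]
    {H : Ω → Matrix (Fin N) (Fin M) ℂ}
    (hlaw : ∀ i j, HasLaw (fun ω => H ω i j) μ P)
    (hindep : iIndepFun (fun (p : Fin N × Fin M) (ω : Ω) => H ω p.1 p.2) P)
    (Γ : Fin n → Matrix (Fin L) (Fin N) ℂ) (A : Matrix (Fin M × Fin n) c ℂ) :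
    ∀ᵐ ω ∂P, ∀ H₀ : Matrix (Fin N) (Fin M) ℂ,
      (extendedChannel Γ H₀ * A).rank ≤ (extendedChannel Γ (H ω) * A).rank := by
  let f : Matrix (Fin N) (Fin M) ℂ → ℕ := fun H₀ => (extendedChannel Γ H₀ * A).rank
  have hbdd : BddAbove (Set.range f) :=
    ⟨Fintype.card c, by rintro _ ⟨H₀, rfl⟩; exact Matrix.rank_le_card_width _⟩
  -- ranks are bounded, so one fixed channel attains the maximum and one null set suffices
  obtain ⟨H₁, hH₁⟩ := Nat.sSup_mem (Set.range_nonempty f) hbdd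
  filter_upwards [ae_rank_extendedChannel_ge hlaw hindep Γ A H₁] with ω hω H₀
  exact ((le_csSup hbdd ⟨H₀, rfl⟩).trans_eq hH₁.symm).trans hω

lemma iIndepFun_user {K M : ℕ} {N : Fin K → ℕ} {Ω : Type*} [MeasurableSpace Ω] {P : Measure Ω}
    {H : Ω → ∀ k, Matrix (Fin (N k)) (Fin M) ℂ}
    (hindep : iIndepFun
      (fun (p : Σ k : Fin K, Fin (N k) × Fin M) (ω : Ω) => H ω p.1 p.2.1 p.2.2) P) (k : Fin K) :
    iIndepFun (fun (p : Fin (N k) × Fin M) (ω : Ω) => H ω k p.1 p.2) P :=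
  hindep.precomp (g := fun p => (⟨k, p⟩ : Σ k : Fin K, Fin (N k) × Fin M))
    (fun a b h => by simpa using h)

/-- The outer bound at a fixed block length. -/
lemma sum_streams_le_blockLength {K M n : ℕ} {N L m : Fin K → ℕ}
    (hL : ∀ k, 1 ≤ L k) (hM : Lmax L < M) (hN : ∀ k, Lmax L < N k)
    {Ω : Type*} [MeasurableSpace Ω] {P : Measure Ω} [IsProbabilityMeasure P]
    {H : Ω → ∀ k, Matrix (Fin (N k)) (Fin M) ℂ} {μ : Measure ℂ} [NullSingletonClass μ]
    (hlaw : ∀ k i j, HasLaw (fun ω => H ω k i j) μ P)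
    (hindep : iIndepFun
      (fun (p : Σ k : Fin K, Fin (N k) × Fin M) (ω : Ω) => H ω p.1 p.2.1 p.2.2) P)
    (V : ∀ k, Matrix (Fin M × Fin n) (Fin (m k)) ℂ)
    (Γ : ∀ k, Fin n → Matrix (Fin (L k)) (Fin (N k)) ℂ)
    (hΓ : ∀ k t, IsSelectionMatrix (Γ k t))
    (hdec : ∀ᵐ ω ∂P, ∀ k, Module.finrank ℂ
      (projCompl (interferenceSpace Γ (H ω) V k) (signalSpace Γ (H ω) V k)) = m k) (k : Fin K) :
    (m k : ℝ) / L k + ∑ j ∈ Finset.univ.erase k, (m j : ℝ) / ((min M (N j) : ℕ) : ℝ) ≤ n := by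
  have hgenΓ : ∀ᵐ ω ∂P, ∀ (S : Finset (Fin K)) (H₀ : Matrix (Fin (N k)) (Fin M) ℂ),
      (extendedChannel (Γ k) H₀ * maskedBeam V S).rank ≤
        (extendedChannel (Γ k) (H ω k) * maskedBeam V S).rank :=
    ae_all_iff.2 fun S =>
      ae_forall_rank_extendedChannel_le (hlaw k) (iIndepFun_user hindep k) (Γ k) _
  have hgen : ∀ᵐ ω ∂P, ∀ j (S : Finset (Fin K)) (H₀ : Matrix (Fin (N j)) (Fin M) ℂ),
      ((Matrix.blockDiagonal fun _ : Fin n => H₀) * maskedBeam V S).rank ≤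
        ((Matrix.blockDiagonal fun _ : Fin n => H ω j) * maskedBeam V S).rank := by
    refine ae_all_iff.2 fun j => ae_all_iff.2 fun S => ?_
    have := ae_forall_rank_extendedChannel_le (hlaw j) (iIndepFun_user hindep j)
      (fun _ : Fin n => (1 : Matrix (Fin (N j)) (Fin (N j)) ℂ)) (maskedBeam V S)
    simpa only [extendedChannel_one] using this
  obtain ⟨ω, hω₁, hω₂, hω₃⟩ := (hgenΓ.and (hgen.and hdec)).exists
  have hdecω := fun j => (finrank_projCompl_eq_iff Γ (H ω) V j).1 (hω₃ j)
  choose G hG hGgen using fun j => exists_generic_factor (fun S => maskedBeam V S) (H ω j) (hω₂ j)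
  have hLT : ∀ i j, L i ≤ min M (N j) := fun i j =>
    (Finset.le_sup (f := L) (Finset.mem_univ i)).trans (le_min hM.le (hN j).le)
  have hGdec : ∀ j (x : ∀ i, Fin (m i) → ℂ),
      (Matrix.blockDiagonal fun _ : Fin n => G j).mulVec (∑ i, (V i).mulVec (x i)) = 0 →
        x j = 0 := by
    intro j x hx
    apply hdecω j
    obtain ⟨D, hD⟩ := hG j
    rw [extendedChannel, hD, Matrix.blockDiagonal_mul, ← Matrix.mulVec_mulVec,
      ← Matrix.mulVec_mulVec, hx]
    simp
  obtain ⟨H₀, hH₀⟩ := exists_rank_maskedBeam_ge V (fun j => (hL j).trans (hLT j j)) G hGdec hGgen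
    (Finset.univ.erase k) (Γ k) (hΓ k) (fun j _ => hLT k j)
  have h1 := rank_maskedBeam_erase_add_le V _ (Finset.mem_univ k) (hdecω k)
  have h2 := Matrix.rank_le_card_height (extendedChannel (Γ k) (H ω k) * maskedBeam V Finset.univ)
  rw [Fintype.card_prod, Fintype.card_fin, Fintype.card_fin] at h2
  have h3 := hω₁ (Finset.univ.erase k) H₀
  have hLk : (0 : ℝ) < L k := by exact_mod_cast hL k
  have h4 : (m k : ℝ) + L k * ∑ j ∈ Finset.univ.erase k, (m j : ℝ) / ((min M (N j) : ℕ) : ℝ) ≤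
      L k * n := by
    have h5 : ((m k + (extendedChannel (Γ k) H₀ * maskedBeam V (Finset.univ.erase k)).rank : ℕ) : ℝ)
        ≤ ((L k * n : ℕ) : ℝ) := Nat.cast_le.2 (by omega)
    push_cast at h5 hH₀ ⊢
    linarith
  rw [← mul_le_mul_iff_right₀ hLk]
  calc _ = (m k : ℝ) + L k * ∑ j ∈ Finset.univ.erase k, (m j : ℝ) / ((min M (N j) : ℕ) : ℝ) := by
        field_simp
    _ ≤ _ := h4

lemma ldofRegion_subset {K M : ℕ} {N L : Fin K → ℕ}
    (hL : ∀ k, 1 ≤ L k) (hM : Lmax L < M) (hN : ∀ k, Lmax L < N k)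
    {Ω : Type*} [MeasurableSpace Ω] {P : Measure Ω} [IsProbabilityMeasure P]
    {H : Ω → ∀ k, Matrix (Fin (N k)) (Fin M) ℂ} {μ : Measure ℂ} [NullSingletonClass μ]
    (hlaw : ∀ k i j, HasLaw (fun ω => H ω k i j) μ P)
    (hindep : iIndepFun
      (fun (p : Σ k : Fin K, Fin (N k) × Fin M) (ω : Ω) => H ω p.1 p.2.1 p.2.2) P) :
    ldofRegion L P H ⊆
      {d : Fin K → ℝ | (∀ k, 0 ≤ d k) ∧
        ∀ k, d k / (L k : ℝ) +
          ∑ j ∈ Finset.univ.erase k, d j / ((min M (N j) : ℕ) : ℝ) ≤ 1} := by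
  refine closure_minimal ?_ ?_
  · rintro d ⟨m, V, Γ, hΓ, hdec, hlim⟩
    refine ⟨fun k => ge_of_tendsto' (hlim k) fun n => by positivity, fun k => ?_⟩
    refine le_of_tendsto (((hlim k).div_const _).add
      (tendsto_finsetSum _ fun j _ => (hlim j).div_const _)) ?_
    filter_upwards [eventually_ge_atTop 1] with n hn
    have h := sum_streams_le_blockLength hL hM hN hlaw hindep (V n) (Γ n) (hΓ n) (hdec n) k
    have hn' : (0 : ℝ) < n := by exact_mod_cast hn
    rw [← div_le_one hn'] at h
    refine le_trans (le_of_eq ?_) h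
    rw [add_div, Finset.sum_div]
    congr 1
    · ring
    · exact Finset.sum_congr rfl fun j _ => by ring
  · have h : {d : Fin K → ℝ | (∀ k, 0 ≤ d k) ∧ ∀ k, d k / (L k : ℝ) +
          ∑ j ∈ Finset.univ.erase k, d j / ((min M (N j) : ℕ) : ℝ) ≤ 1} =
        (⋂ k, {d | 0 ≤ d k}) ∩ ⋂ k, {d | d k / (L k : ℝ) +
          ∑ j ∈ Finset.univ.erase k, d j / ((min M (N j) : ℕ) : ℝ) ≤ 1} := by
      ext d; simp
    rw [h]
    refine (isClosed_iInter fun k => isClosed_le (by fun_prop) (by fun_prop)).inter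
      (isClosed_iInter fun k => isClosed_le (by fun_prop) (by fun_prop))

/-! ### Linear schemes over arbitrary slots -/

lemma extendedChannel_mulVec_apply {M N L n : ℕ} (Γ : Fin n → Matrix (Fin L) (Fin N) ℂ)
    (H : Matrix (Fin N) (Fin M) ℂ) (y : Fin M × Fin n → ℂ) (l : Fin L) (t : Fin n) :
    (extendedChannel Γ H).mulVec y (l, t) =
      (Γ t).mulVec (H.mulVec fun a => y (a, t)) l := by
  rw [extendedChannel, ← Matrix.blockDiagonal_mul, Matrix.mulVec_mulVec]
  simp [Matrix.mulVec, dotProduct, Fintype.sum_prod_type, Matrix.blockDiagonal_apply, ite_mul]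

/-- A linear scheme with the slots `τ` and the symbols `σ k` of user `k`: beamforming matrices and
modes for each slot, independent of the channel realization, with which almost surely every user can
decode, in the form of `finrank_projCompl_eq_iff`. Arbitrary types as labels spare the numbering of
slots and symbols. -/
def IsFeasible {K M : ℕ} {N : Fin K → ℕ} (L : Fin K → ℕ)
    {Ω : Type*} [MeasurableSpace Ω] (P : Measure Ω)
    (H : Ω → ∀ k, Matrix (Fin (N k)) (Fin M) ℂ)
    (τ : Type*) (σ : Fin K → Type*) [∀ k, Fintype (σ k)] : Prop :=
  ∃ (V : ∀ k, τ → Matrix (Fin M) (σ k) ℂ) (Γ : ∀ k, τ → Matrix (Fin (L k)) (Fin (N k)) ℂ),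
    (∀ k t, IsSelectionMatrix (Γ k t)) ∧
    ∀ᵐ ω ∂P, ∀ k, ∀ x : ∀ j, σ j → ℂ,
      (∀ t, (Γ k t).mulVec ((H ω k).mulVec (∑ j, (V j t).mulVec (x j))) = 0) → x k = 0

section
variable {K M : ℕ} {N L : Fin K → ℕ} {Ω : Type*} [MeasurableSpace Ω] {P : Measure Ω}
  {H : Ω → ∀ k, Matrix (Fin (N k)) (Fin M) ℂ}

lemma IsFeasible.congr {τ τ' : Type*} {σ σ' : Fin K → Type*} [∀ k, Fintype (σ k)]
    [∀ k, Fintype (σ' k)] (h : IsFeasible L P H τ σ) (e : τ' ≃ τ) (f : ∀ k, σ' k ≃ σ k) :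
    IsFeasible L P H τ' σ' := by
  obtain ⟨V, Γ, hΓ, hdec⟩ := h
  refine ⟨fun k t => (V k (e t)).submatrix id (f k), fun k t => Γ k (e t),
    fun k t => hΓ k _, ?_⟩
  filter_upwards [hdec] with ω hω k x hx
  have := hω k (fun j s => x j ((f j).symm s)) (fun t => by
    rw [← hx (e.symm t)]
    simp only [Equiv.apply_symm_apply]
    congr 3
    funext j
    ext a
    simp only [Matrix.mulVec, dotProduct, Matrix.submatrix_apply, id]
    exact (Fintype.sum_equiv (f j) _ _ (fun s => by simp)).symm)
  ext s
  simpa using congrFun this (f k s)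

lemma exists_isSelectionMatrix {L N : ℕ} (h : L ≤ N) :
    ∃ Γ : Matrix (Fin L) (Fin N) ℂ, IsSelectionMatrix Γ := by
  refine ⟨Matrix.of fun l => Pi.single (Fin.castLE h l) 1, fun l => ⟨_, rfl⟩, fun a b hab => ?_⟩
  have := congrFun hab (Fin.castLE h a)
  by_contra hne
  have hne' : Fin.castLE h a ≠ Fin.castLE h b := fun h' => hne (Fin.castLE_injective h h')
  simp [hne'] at this

/-- `a` repetitions of a scheme followed by `b` idle slots. -/
lemma IsFeasible.repeat {τ : Type*} {σ : Fin K → Type*} [∀ k, Fintype (σ k)]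
    (h : IsFeasible L P H τ σ) (hLN : ∀ k, L k ≤ N k) (a b : ℕ) :
    IsFeasible L P H ((Fin a × τ) ⊕ Fin b) (fun k => Fin a × σ k) := by
  obtain ⟨V, Γ, hΓ, hdec⟩ := h
  choose Γ₀ hΓ₀ using fun k => exists_isSelectionMatrix (hLN k)
  refine ⟨fun k => Sum.elim
      (fun t => Matrix.of fun i s => if s.1 = t.1 then V k t.2 i s.2 else 0) (fun _ => 0),
    fun k => Sum.elim (fun t => Γ k t.2) (fun _ => Γ₀ k), ?_, ?_⟩
  · rintro k (t | t)
    · exact hΓ k _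
    · exact hΓ₀ k
  · filter_upwards [hdec] with ω hω k x hx
    ext ⟨i, s⟩
    refine congrFun (hω k (fun j s => x j (i, s)) fun t => ?_) s
    rw [← hx (Sum.inl (i, t))]
    simp only [Sum.elim_inl]
    congr 3
    funext j
    ext c
    simp [Matrix.mulVec, dotProduct, Fintype.sum_prod_type_right]

lemma IsFeasible.exists_finrank_eq {n : ℕ} {m : Fin K → ℕ}
    (h : IsFeasible L P H (Fin n) (fun k => Fin (m k))) :
    ∃ (V : ∀ k, Matrix (Fin M × Fin n) (Fin (m k)) ℂ)
      (Γ : ∀ k, Fin n → Matrix (Fin (L k)) (Fin (N k)) ℂ),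
      (∀ k t, IsSelectionMatrix (Γ k t)) ∧
      ∀ᵐ ω ∂P, ∀ k, Module.finrank ℂ
        (projCompl (interferenceSpace Γ (H ω) V k) (signalSpace Γ (H ω) V k)) = m k := by
  obtain ⟨V, Γ, hΓ, hdec⟩ := h
  refine ⟨fun k => Matrix.of fun p s => V k p.2 p.1 s, Γ, hΓ, ?_⟩
  filter_upwards [hdec] with ω hω k
  rw [finrank_projCompl_eq_iff]
  intro x hx
  refine hω k x fun t => ?_
  ext l
  have := congrFun hx (l, t)
  rw [extendedChannel_mulVec_apply] at this
  refine Eq.trans ?_ this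
  congr 3
  ext a
  simp [Matrix.mulVec, dotProduct]

lemma IsFeasible.isAchievableLDoF {τ : Type*} {σ : Fin K → Type*} [Fintype τ] [Nonempty τ]
    [∀ k, Fintype (σ k)] (h : IsFeasible L P H τ σ) (hLN : ∀ k, L k ≤ N k) :
    IsAchievableLDoF L P H (fun k => (Fintype.card (σ k) : ℝ) / Fintype.card τ) := by
  set n₀ := Fintype.card τ with hn₀
  have hn₀pos : 0 < n₀ := Fintype.card_pos
  have hex : ∀ n : ℕ, IsFeasible L P H (Fin n)
      (fun k => Fin ((n / n₀) * Fintype.card (σ k))) := by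
    intro n
    refine (h.repeat hLN (n / n₀) (n % n₀)).congr (Fintype.equivOfCardEq ?_)
      (fun k => Fintype.equivOfCardEq ?_)
    · simp only [Fintype.card_fin, Fintype.card_sum, Fintype.card_prod]
      rw [← hn₀, mul_comm]
      exact (Nat.div_add_mod n n₀).symm
    · simp
  choose V Γ hΓ hdec using fun n => (hex n).exists_finrank_eq
  refine ⟨fun n k => (n / n₀) * Fintype.card (σ k), V, Γ, hΓ, hdec, fun k => ?_⟩
  have h1 : Tendsto (fun n : ℕ => ((n / n₀ : ℕ) : ℝ) / n) atTop (𝓝 (1 / (n₀ : ℝ))) := by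
    have := (tendsto_nat_floor_mul_div_atTop (R := ℝ) (a := 1 / (n₀ : ℝ)) (by positivity)).comp
      tendsto_natCast_atTop_atTop
    refine this.congr fun n => ?_
    simp only [Function.comp]
    rw [one_div, inv_mul_eq_div, Nat.floor_div_eq_div]
  have h2 := h1.mul_const (Fintype.card (σ k) : ℝ)
  have h3 : (Fintype.card (σ k) : ℝ) / n₀ = 1 / (n₀ : ℝ) * Fintype.card (σ k) := by ring
  simp only [h3]
  refine h2.congr fun n => ?_
  push_cast
  ring

end

/-- The mode of RF-chain `l` at the value `u` of the clock: the chains run cyclically through the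
first `T` modes, `L` modes at a time. -/
def cyclicMode {L T N : ℕ} (hT : 0 < T) (hTN : T ≤ N) (u : ℕ) (l : Fin L) : Fin N :=
  ⟨(u * L + l) % T, (Nat.mod_lt _ hT).trans_le hTN⟩

/-- The selection matrix of `cyclicMode`. -/
def modeMatrix {L T N : ℕ} (hT : 0 < T) (hTN : T ≤ N) (u : ℕ) : Matrix (Fin L) (Fin N) ℂ :=
  Matrix.of fun l => Pi.single (cyclicMode hT hTN u l) 1

lemma isSelectionMatrix_modeMatrix {L T N : ℕ} (hT : 0 < T) (hTN : T ≤ N) (hLT : L ≤ T) (u : ℕ) :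
    IsSelectionMatrix (modeMatrix hT hTN u : Matrix (Fin L) (Fin N) ℂ) := by
  refine ⟨fun l => ⟨_, rfl⟩, fun a b hab => ?_⟩
  have h1 : cyclicMode hT hTN u a = cyclicMode hT hTN u b := by
    by_contra hne
    have := congrFun hab (cyclicMode hT hTN u a)
    simp [modeMatrix, hne] at this
  have h2 : (u * L + a) ≡ (u * L + b) [MOD T] := congrArg Fin.val h1
  have h3 := Nat.ModEq.add_left_cancel' _ h2
  exact Fin.ext (h3.eq_of_lt_of_lt (a.2.trans_le hLT) (b.2.trans_le hLT))

lemma modeMatrix_mulVec {L T N : ℕ} (hT : 0 < T) (hTN : T ≤ N) (u : ℕ) (y : Fin N → ℂ)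
    (l : Fin L) : (modeMatrix hT hTN u).mulVec y l = y (cyclicMode hT hTN u l) := by
  simp [modeMatrix, Matrix.mulVec]

lemma eq_zero_of_sum_pow_mul_eq_zero {r : ℕ} {v : Fin r → ℂ} (hv : Function.Injective v)
    {z : Fin r → ℂ} (h : ∀ a, ∑ β : Fin r, v a ^ (β : ℕ) * z β = 0) : z = 0 :=
  Matrix.eq_zero_of_mulVec_eq_zero (Matrix.det_vandermonde_ne_zero_iff.2 hv)
    (funext fun a => h a)

lemma rank_eq_card_iff_mulVec_injective {m n : Type*} [Fintype m] [Fintype n]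
    (B : Matrix m n ℂ) :
    B.rank = Fintype.card n ↔ ∀ z, B.mulVec z = 0 → z = 0 := by
  have h := B.mulVecLin.finrank_range_add_finrank_ker
  rw [Module.finrank_fintype_fun_eq_card] at h
  have h2 : (∀ z, B.mulVec z = 0 → z = 0) ↔ Module.finrank ℂ (LinearMap.ker B.mulVecLin) = 0 := by
    rw [Submodule.finrank_eq_zero, LinearMap.ker_eq_bot']
    rfl
  rw [h2, Matrix.rank]
  omega

/-- Without interference, a user decodes `r` vectors of `T` symbols from `Q + r` observations of
their Vandermonde combinations. It is enough to check this for the channel that is the identity on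
the first `T` modes and antennas: there, mode `i` observes component `i` of the combinations, and it
is observed at least `r` times. -/
lemma ae_decode_single_user {M N L T Q r : ℕ} {Ω : Type*} [MeasurableSpace Ω] {P : Measure Ω}
    [IsProbabilityMeasure P] {μ : Measure ℂ} [NullSingletonClass μ]
    {H : Ω → Matrix (Fin N) (Fin M) ℂ}
    (hlaw : ∀ i j, HasLaw (fun ω => H ω i j) μ P)
    (hindep : iIndepFun (fun (p : Fin N × Fin M) (ω : Ω) => H ω p.1 p.2) P)
    (hT : 0 < T) (hTN : T ≤ N) (hTM : T ≤ M) (hL : 1 ≤ L) (hLT : L ≤ T)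
    (hr : r * T ≤ (Q + r) * L) :
    ∀ᵐ ω ∂P, ∀ z : Fin r × Fin T → ℂ,
      (∀ u : ℕ, u < Q + r → (modeMatrix hT hTN u : Matrix (Fin L) (Fin N) ℂ).mulVec
        ((H ω).mulVec fun a => ∑ β : Fin r, ∑ i : Fin T,
          if a = Fin.castLE hTM i then (u : ℂ) ^ (β : ℕ) * z (β, i) else 0) = 0) → z = 0 := by
  let A : Matrix (Fin M × Fin (Q + r)) (Fin r × Fin T) ℂ := Matrix.of fun p s =>
    if p.1 = Fin.castLE hTM s.2 then ((p.2 : ℕ) : ℂ) ^ (s.1 : ℕ) else 0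
  let Γ : Fin (Q + r) → Matrix (Fin L) (Fin N) ℂ := fun u => modeMatrix hT hTN u
  let H₀ : Matrix (Fin N) (Fin M) ℂ := Matrix.of fun i a => if (i : ℕ) = a then 1 else 0
  have hA : ∀ (G : Matrix (Fin N) (Fin M) ℂ) (z : Fin r × Fin T → ℂ) (l : Fin L) (u : Fin (Q + r)),
      (extendedChannel Γ G * A).mulVec z (l, u) =
        (modeMatrix hT hTN u : Matrix (Fin L) (Fin N) ℂ).mulVec
        (G.mulVec fun a => ∑ β : Fin r, ∑ i : Fin T,
          if a = Fin.castLE hTM i then ((u : ℕ) : ℂ) ^ (β : ℕ) * z (β, i) else 0) l := by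
    intro G z l u
    rw [← Matrix.mulVec_mulVec, extendedChannel_mulVec_apply]
    congr 3
    ext a
    simp [A, Matrix.mulVec, dotProduct, Fintype.sum_prod_type]
  -- Number the observations of all chains by `u L + l`. Component `i` is observed at the numbers
  -- `i + a T`, and those with `a < r` belong to different times as `L ≤ T`.
  have h₀ : (extendedChannel Γ H₀ * A).rank = Fintype.card (Fin r × Fin T) := by
    rw [rank_eq_card_iff_mulVec_injective]
    intro z hz
    ext ⟨β, i⟩
    have hpos : ∀ a : Fin r, (i : ℕ) + a * T < r * T := fun a =>
      calc (i : ℕ) + a * T < (a + 1) * T := by rw [add_one_mul]; omega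
        _ ≤ r * T := Nat.mul_le_mul_right _ a.2
    have hu : ∀ a : Fin r, ((i : ℕ) + a * T) / L < Q + r := fun a =>
      Nat.div_lt_of_lt_mul (((hpos a).trans_le hr).trans_eq (mul_comm _ _))
    have hinj : Function.Injective fun a : Fin r => ((((i : ℕ) + a * T) / L : ℕ) : ℂ) := by
      have hmono : StrictMono fun a : Fin r => ((i : ℕ) + a * T) / L := by
        intro a b hab
        have h1 : (i : ℕ) + a * T + L ≤ i + b * T := by
          have : ((a : ℕ) + 1) * T ≤ b * T := Nat.mul_le_mul_right _ hab
          rw [add_one_mul] at this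
          omega
        calc ((i : ℕ) + a * T) / L < ((i : ℕ) + a * T) / L + 1 := Nat.lt_succ_self _
          _ = ((i : ℕ) + a * T + L) / L := (Nat.add_div_right _ hL).symm
          _ ≤ _ := Nat.div_le_div_right h1
      exact Nat.cast_injective.comp hmono.injective
    refine congrFun (eq_zero_of_sum_pow_mul_eq_zero hinj (z := fun β => z (β, i)) fun a => ?_) β
    have := hA H₀ z ⟨((i : ℕ) + a * T) % L, Nat.mod_lt _ hL⟩ ⟨_, hu a⟩
    rw [hz, modeMatrix_mulVec] at this
    have hmode : ((cyclicMode hT hTN (((i : ℕ) + a * T) / L)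
        (⟨((i : ℕ) + a * T) % L, Nat.mod_lt _ hL⟩ : Fin L) : Fin N) : ℕ) = i := by
      simp only [cyclicMode]
      rw [mul_comm, Nat.div_add_mod, Nat.add_mul_mod_self_right, Nat.mod_eq_of_lt i.2]
    simp only [Matrix.mulVec, dotProduct, H₀, Matrix.of_apply, hmode, ite_mul, one_mul,
      zero_mul, Pi.zero_apply] at this
    rw [Finset.sum_eq_single (Fin.castLE hTM i)] at this
    · simp only [Fin.val_castLE, if_true, (Fin.castLE_injective hTM).eq_iff,
        Finset.sum_ite_eq, Finset.mem_univ] at this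
      exact this.symm
    · intro c _ hc
      rw [if_neg]
      intro h
      exact hc (Fin.ext h.symm)
    · simp
  filter_upwards [ae_rank_extendedChannel_ge hlaw hindep Γ A H₀] with ω hω z hz
  rw [h₀] at hω
  refine (rank_eq_card_iff_mulVec_injective _).1
    (le_antisymm (Matrix.rank_le_card_width _) hω) z ?_
  ext ⟨l, u⟩
  rw [hA, hz u u.2]
  rfl

/-! ### The blind interference alignment scheme -/

/-- The slots: common slots, labelled by the clocks of all users, and the private slots of user `k`,
labelled by a private value of its clock and by the common values of the other clocks. -/
abbrev AlignmentSlot {K : ℕ} (Q : ℕ) (r : Fin K → ℕ) : Type :=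
  (Fin K → Fin Q) ⊕ Σ k : Fin K, Fin (r k) × ({j : Fin K // j ≠ k} → Fin Q)

/-- The symbols of user `k`: on each line, that is, for fixed values of the other clocks, `r k`
vectors with `T k` components. -/
abbrev AlignmentStream {K : ℕ} (Q : ℕ) (r T : Fin K → ℕ) (k : Fin K) : Type :=
  Fin (r k) × ({j : Fin K // j ≠ k} → Fin Q) × Fin (T k)

/-- The clock of user `k`. It shows `Q + β` in the private slot `β` of the user, and a common value,
below `Q`, in all other slots. -/
def alignmentClock {K Q : ℕ} {r : Fin K → ℕ} (k : Fin K) : AlignmentSlot Q r → ℕ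
  | Sum.inl t => t k
  | Sum.inr ⟨k', β, b⟩ => if h : k = k' then Q + β else b ⟨k, h⟩

/-- In a slot of one of its lines, user `k` is sent the combination of the vectors of the line with
coefficients `u ^ β`, where `u` is the value of its clock; the vectors use the first `T k` antennas.
It is sent nothing in the private slots of others. -/
noncomputable def alignmentBeam {K M Q : ℕ} {r T : Fin K → ℕ} (hTM : ∀ k, T k ≤ M) (k : Fin K) :
    AlignmentSlot Q r → Matrix (Fin M) (AlignmentStream Q r T k) ℂ
  | Sum.inl t => Matrix.of fun a s =>
    if (fun j : {j : Fin K // j ≠ k} => t j) = s.2.1 then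
      (if a = Fin.castLE (hTM k) s.2.2 then ((t k : ℕ) : ℂ) ^ (s.1 : ℕ) else 0) else 0
  | Sum.inr ⟨k', β, b⟩ => Matrix.of fun a s =>
    if (⟨k', b⟩ : Σ k : Fin K, {j : Fin K // j ≠ k} → Fin Q) = ⟨k, s.2.1⟩ then
      (if a = Fin.castLE (hTM k) s.2.2 then ((Q + β : ℕ) : ℂ) ^ (s.1 : ℕ) else 0) else 0

/-- The antenna vector that carries the symbols number `β` of user `k` on the line `b`. -/
def lineVector {K M Q : ℕ} {r T : Fin K → ℕ} (hTM : ∀ k, T k ≤ M) (k : Fin K)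
    (x : AlignmentStream Q r T k → ℂ) (b : {j : Fin K // j ≠ k} → Fin Q) (β : Fin (r k)) :
    Fin M → ℂ :=
  fun a => ∑ i : Fin (T k), if a = Fin.castLE (hTM k) i then x (β, b, i) else 0

lemma alignmentBeam_inl_mulVec {K M Q : ℕ} {r T : Fin K → ℕ} (hTM : ∀ k, T k ≤ M) (k : Fin K)
    (t : Fin K → Fin Q) (x : AlignmentStream Q r T k → ℂ) :
    (alignmentBeam (r := r) hTM k (Sum.inl t)).mulVec x =
      ∑ β : Fin (r k), ((t k : ℕ) : ℂ) ^ (β : ℕ) • lineVector hTM k x (fun j => t j) β := by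
  ext a
  simp only [alignmentBeam, Matrix.mulVec, dotProduct, Matrix.of_apply, Fintype.sum_prod_type,
    Finset.sum_apply, Pi.smul_apply, lineVector, smul_eq_mul]
  refine Finset.sum_congr rfl fun β _ => ?_
  rw [Finset.sum_eq_single (fun j : {j : Fin K // j ≠ k} => t j)]
  · rw [Finset.mul_sum]
    refine Finset.sum_congr rfl fun i _ => ?_
    simp
  · intro b _ hb
    simp [Ne.symm hb]
  · simp

lemma alignmentBeam_inr_mulVec {K M Q : ℕ} {r T : Fin K → ℕ} (hTM : ∀ k, T k ≤ M) (k : Fin K)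
    (β' : Fin (r k)) (b : {j : Fin K // j ≠ k} → Fin Q) (x : AlignmentStream Q r T k → ℂ) :
    (alignmentBeam (r := r) hTM k (Sum.inr ⟨k, β', b⟩)).mulVec x =
      ∑ β : Fin (r k), ((Q + β' : ℕ) : ℂ) ^ (β : ℕ) • lineVector hTM k x b β := by
  ext a
  simp only [alignmentBeam, Matrix.mulVec, dotProduct, Matrix.of_apply, Fintype.sum_prod_type,
    Finset.sum_apply, Pi.smul_apply, lineVector, smul_eq_mul]
  refine Finset.sum_congr rfl fun β _ => ?_
  rw [Finset.sum_eq_single b]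
  · rw [Finset.mul_sum]
    refine Finset.sum_congr rfl fun i _ => ?_
    simp
  · intro c _ hc
    simp [Ne.symm hc]
  · simp

lemma alignmentBeam_inr_of_ne {K M Q : ℕ} {r T : Fin K → ℕ} (hTM : ∀ k, T k ≤ M) {j k : Fin K}
    (hjk : j ≠ k) (β : Fin (r j)) (b : {i : Fin K // i ≠ j} → Fin Q) :
    alignmentBeam (r := r) (T := T) hTM k (Sum.inr ⟨j, β, b⟩) = 0 := by
  ext a s
  simp [alignmentBeam, hjk]

lemma isFeasible_alignment {K M Q : ℕ} {N L r T : Fin K → ℕ}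
    {Ω : Type*} [MeasurableSpace Ω] {P : Measure Ω} [IsProbabilityMeasure P]
    {H : Ω → ∀ k, Matrix (Fin (N k)) (Fin M) ℂ} {μ : Measure ℂ} [NullSingletonClass μ]
    (hlaw : ∀ k i j, HasLaw (fun ω => H ω k i j) μ P)
    (hindep : iIndepFun
      (fun (p : Σ k : Fin K, Fin (N k) × Fin M) (ω : Ω) => H ω p.1 p.2.1 p.2.2) P)
    (hL : ∀ k, 1 ≤ L k) (hLT : ∀ k, L k ≤ T k) (hTN : ∀ k, T k ≤ N k) (hTM : ∀ k, T k ≤ M)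
    (hr : ∀ k, r k * T k ≤ (Q + r k) * L k) :
    IsFeasible L P H (AlignmentSlot Q r) (AlignmentStream Q r T) := by
  have hT : ∀ k, 0 < T k := fun k => (hL k).trans (hLT k)
  refine ⟨fun k => alignmentBeam hTM k,
    fun k s => modeMatrix (hT k) (hTN k) (alignmentClock k s),
    fun k s => isSelectionMatrix_modeMatrix _ _ (hLT k) _, ?_⟩
  filter_upwards [ae_all_iff.2 fun k => ae_decode_single_user (hlaw k) (iIndepFun_user hindep k)
    (hT k) (hTN k) (hTM k) (hL k) (hLT k) (hr k)] with ω hω k x hx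
  -- the mode of user `k` and its channel, at the time `u` of its clock
  let E : ℕ → Matrix (Fin (L k)) (Fin M) ℂ := fun u => modeMatrix (hT k) (hTN k) u * H ω k
  -- in the private slots of user `j`, only the vectors of user `j` are on the air
  have hprivate : ∀ (j : Fin K) (β' : Fin (r j)) (b : {i : Fin K // i ≠ j} → Fin Q),
      (E (alignmentClock k (Sum.inr ⟨j, β', b⟩ : AlignmentSlot Q r))).mulVec
        (∑ β : Fin (r j), ((Q + β' : ℕ) : ℂ) ^ (β : ℕ) • lineVector hTM j (x j) b β) = 0 := by
    intro j β' b
    have h := hx (Sum.inr ⟨j, β', b⟩)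
    rw [Finset.sum_eq_single j, alignmentBeam_inr_mulVec, Matrix.mulVec_mulVec] at h
    · exact h
    · intro i _ hi
      rw [alignmentBeam_inr_of_ne hTM (Ne.symm hi)]
      simp
    · simp
  -- the mode of user `k` is the same in all private slots of a line of user `j`, so the Vandermonde
  -- combinations can be separated
  have hinterf : ∀ (j : Fin K) (hj : k ≠ j) (b : {i : Fin K // i ≠ j} → Fin Q) (β : Fin (r j)),
      (E (b ⟨k, hj⟩)).mulVec (lineVector hTM j (x j) b β) = 0 := by
    intro j hj b β
    ext l
    refine congrFun (eq_zero_of_sum_pow_mul_eq_zero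
      (v := fun β' : Fin (r j) => ((Q + β' : ℕ) : ℂ)) ?_
      (z := fun β => (E (b ⟨k, hj⟩)).mulVec (lineVector hTM j (x j) b β) l) fun β' => ?_) β
    · intro a c hac
      have := Nat.cast_injective (R := ℂ) hac
      exact Fin.ext (by omega)
    · have h := congrFun (hprivate j β' b) l
      simp only [alignmentClock, dif_neg hj, Matrix.mulVec_sum, Matrix.mulVec_smul,
        Finset.sum_apply, Pi.smul_apply, smul_eq_mul] at h
      exact h
  -- in the common slots the interference vanishes by `hinterf`, since the mode of user `k` there
  -- is the one it has in the private slots of the interfering lines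
  have hclean : ∀ (b : {i : Fin K // i ≠ k} → Fin Q) (u : ℕ), u < Q + r k →
      (E u).mulVec (∑ β : Fin (r k), (u : ℂ) ^ (β : ℕ) • lineVector hTM k (x k) b β) = 0 := by
    intro b u hu
    rcases lt_or_ge u Q with huQ | huQ
    · let t : Fin K → Fin Q := fun j => if h : j = k then ⟨u, huQ⟩ else b ⟨j, h⟩
      have htk : (t k : ℕ) = u := by simp [t]
      have htb : (fun j : {j : Fin K // j ≠ k} => t j) = b := by
        funext j; simp [t, j.2]
      have h := hx (Sum.inl t)
      rw [Matrix.mulVec_mulVec, Matrix.mulVec_sum, Finset.sum_eq_single k] at h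
      · rw [alignmentBeam_inl_mulVec, htb, htk] at h
        simpa only [alignmentClock, htk] using h
      · intro j _ hj
        rw [alignmentBeam_inl_mulVec, Matrix.mulVec_sum]
        refine Finset.sum_eq_zero fun β _ => ?_
        rw [Matrix.mulVec_smul]
        have := hinterf j (Ne.symm hj) (fun i => t i) β
        simp only [alignmentClock]
        exact (congrArg _ this).trans (smul_zero _)
      · simp
    · have h := hprivate k ⟨u - Q, by omega⟩ b
      simpa [alignmentClock, Nat.add_sub_cancel' huQ] using h
  ext ⟨β, b, i⟩
  refine congrFun (hω k (fun p => x k (p.1, b, p.2)) fun u hu => ?_) (β, i)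
  rw [Matrix.mulVec_mulVec]
  refine Eq.trans ?_ (hclean b u hu)
  congr 1
  ext a
  simp only [Finset.sum_apply, Pi.smul_apply, lineVector, smul_eq_mul, Finset.mul_sum, mul_ite,
    mul_zero]

lemma card_alignmentStream_div_card_alignmentSlot {K : ℕ} {Q : ℕ} (hQ : 0 < Q) (r T : Fin K → ℕ)
    (k : Fin K) :
    (Fintype.card (AlignmentStream Q r T k) : ℝ) / Fintype.card (AlignmentSlot Q r) =
      (r k : ℝ) / Q * T k / (1 + ∑ j, (r j : ℝ) / Q) := by
  have hQ' : (0 : ℝ) < Q := by exact_mod_cast hQ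
  obtain ⟨K', rfl⟩ : ∃ K', K = K' + 1 := ⟨K - 1, by have := k.pos; omega⟩
  have hslot : (Fintype.card (AlignmentSlot Q r) : ℝ) =
      (Q : ℝ) ^ (K' + 1) * (1 + ∑ j, (r j : ℝ) / Q) := by
    simp only [AlignmentSlot, Fintype.card_sum, Fintype.card_sigma, Fintype.card_prod,
      Fintype.card_fun, Fintype.card_fin, ne_eq, Fintype.card_subtype_compl, Fintype.card_unique,
      Nat.add_sub_cancel]
    push_cast
    rw [mul_add, mul_one, Finset.mul_sum]
    congr 1
    refine Finset.sum_congr rfl fun j _ => ?_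
    field_simp
    ring
  have hstream : (Fintype.card (AlignmentStream Q r T k) : ℝ) =
      (Q : ℝ) ^ (K' + 1) * ((r k : ℝ) / Q * T k) := by
    simp only [AlignmentStream, Fintype.card_prod, Fintype.card_fun, Fintype.card_fin, ne_eq,
      Fintype.card_subtype_compl, Fintype.card_unique, Nat.add_sub_cancel]
    push_cast
    field_simp
    ring
  rw [hslot, hstream, mul_div_mul_left _ _ (by positivity)]

/-- The tuples with `∑ d_j / T_j < 1` are limits, as `Q → ∞`, of tuples of the alignment scheme with
`r_k = ⌊ρ_k Q⌋`, where `ρ_k = d_k / (T_k (1 - ∑ d_j / T_j))`. Rounding down keeps `r_k` admissible.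
-/
lemma mem_ldofRegion_of_sum_lt_one {K M : ℕ} {N L T : Fin K → ℕ}
    {Ω : Type*} [MeasurableSpace Ω] {P : Measure Ω} [IsProbabilityMeasure P]
    {H : Ω → ∀ k, Matrix (Fin (N k)) (Fin M) ℂ} {μ : Measure ℂ} [NullSingletonClass μ]
    (hlaw : ∀ k i j, HasLaw (fun ω => H ω k i j) μ P)
    (hindep : iIndepFun
      (fun (p : Σ k : Fin K, Fin (N k) × Fin M) (ω : Ω) => H ω p.1 p.2.1 p.2.2) P)
    (hL : ∀ k, 1 ≤ L k) (hLT : ∀ k, L k ≤ T k) (hTN : ∀ k, T k ≤ N k) (hTM : ∀ k, T k ≤ M)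
    {d : Fin K → ℝ} (hd : ∀ k, 0 ≤ d k) (hσ : ∑ j, d j / T j < 1)
    (hreg : ∀ k, d k / L k + ∑ j ∈ Finset.univ.erase k, d j / T j ≤ 1) :
    d ∈ ldofRegion L P H := by
  set σ := ∑ j, d j / (T j : ℝ) with hσdef
  have hT : ∀ k, (0 : ℝ) < T k := fun k => by exact_mod_cast (hL k).trans (hLT k)
  have hL' : ∀ k, (0 : ℝ) < L k := fun k => by exact_mod_cast hL k
  have hLT' : ∀ k, (L k : ℝ) ≤ T k := fun k => by exact_mod_cast hLT k
  have h1σ : 0 < 1 - σ := by linarith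
  let ρ : Fin K → ℝ := fun k => d k / T k / (1 - σ)
  have hρ0 : ∀ k, 0 ≤ ρ k := fun k => by have := hd k; have := hT k; positivity
  have hρ : ∀ k, ρ k * (T k - L k) ≤ L k := by
    intro k
    have h1 := hreg k
    have h2 := Finset.add_sum_erase Finset.univ (fun j => d j / (T j : ℝ)) (Finset.mem_univ k)
    have h3 : d k / L k - d k / T k ≤ 1 - σ := by
      rw [hσdef, ← h2]; linarith
    have h4 : ρ k * (T k - L k) = (d k / L k - d k / T k) * (L k / (1 - σ)) := by
      simp only [ρ]
      have := (hT k).ne'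
      have := (hL' k).ne'
      field_simp
    rw [h4]
    calc _ ≤ (1 - σ) * (L k / (1 - σ)) :=
          mul_le_mul_of_nonneg_right h3 (div_nonneg (hL' k).le h1σ.le)
      _ = L k := by field_simp
  let r : ℕ → Fin K → ℕ := fun Q k => ⌊ρ k * Q⌋₊
  have hr : ∀ Q k, r Q k * T k ≤ (Q + r Q k) * L k := by
    intro Q k
    have h1 : (r Q k : ℝ) ≤ ρ k * Q := Nat.floor_le (mul_nonneg (hρ0 k) (Nat.cast_nonneg Q))
    have h2 : (r Q k : ℝ) * (T k - L k) ≤ Q * L k :=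
      calc (r Q k : ℝ) * (T k - L k) ≤ ρ k * Q * (T k - L k) :=
            mul_le_mul_of_nonneg_right h1 (sub_nonneg.2 (hLT' k))
        _ = Q * (ρ k * (T k - L k)) := by ring
        _ ≤ Q * L k := mul_le_mul_of_nonneg_left (hρ k) (Nat.cast_nonneg Q)
    have h3 : ((r Q k * T k : ℕ) : ℝ) ≤ (((Q + r Q k) * L k : ℕ) : ℝ) := by
      push_cast
      linarith
    exact_mod_cast h3
  have hlim : ∀ k, Tendsto (fun Q : ℕ => (r Q k : ℝ) / Q) atTop (𝓝 (ρ k)) := fun k =>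
    (tendsto_nat_floor_mul_div_atTop (hρ0 k)).comp tendsto_natCast_atTop_atTop
  have hsum : 1 + ∑ j, ρ j = 1 / (1 - σ) := by
    simp only [ρ]
    rw [← Finset.sum_div, ← hσdef]
    field_simp
    ring
  have hdlim : Tendsto (fun Q : ℕ => fun k =>
      (r Q k : ℝ) / Q * T k / (1 + ∑ j, (r Q j : ℝ) / Q)) atTop (𝓝 d) := by
    rw [tendsto_pi_nhds]
    intro k
    have h := ((hlim k).mul_const (T k : ℝ)).div
      ((tendsto_finsetSum Finset.univ fun j _ => hlim j).const_add 1)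
      (by rw [hsum]; positivity)
    have hdk : ρ k * T k / (1 + ∑ j, ρ j) = d k := by
      rw [hsum]
      simp only [ρ]
      have := (hT k).ne'
      field_simp
    rw [hdk] at h
    exact h
  refine mem_closure_of_tendsto hdlim ?_
  filter_upwards [eventually_ge_atTop 1] with Q hQ
  have : Nonempty (AlignmentSlot Q (r Q)) := ⟨Sum.inl fun _ => ⟨0, hQ⟩⟩
  have h := (isFeasible_alignment hlaw hindep hL hLT hTN hTM (hr Q)).isAchievableLDoF
    (fun k => (hLT k).trans (hTN k))
  simpa only [card_alignmentStream_div_card_alignmentSlot (show 0 < Q from hQ)] using h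

theorem theorem2 {K M : ℕ} (N L : Fin K → ℕ)
    (hL : ∀ k, 1 ≤ L k) (hM : Lmax L < M) (hN : ∀ k, Lmax L < N k)
    {Ω : Type*} [MeasurableSpace Ω] (P : Measure Ω) [IsProbabilityMeasure P]
    (H : Ω → ∀ k, Matrix (Fin (N k)) (Fin M) ℂ)
    (μ : Measure ℂ) [NullSingletonClass μ]
    (hlaw : ∀ k i j, HasLaw (fun ω => H ω k i j) μ P)
    (hindep : iIndepFun
      (fun (p : Σ k : Fin K, Fin (N k) × Fin M) (ω : Ω) => H ω p.1 p.2.1 p.2.2) P) :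
    ldofRegion L P H =
      {d : Fin K → ℝ | (∀ k, 0 ≤ d k) ∧
        ∀ k, d k / (L k : ℝ) +
          ∑ j ∈ Finset.univ.erase k, d j / ((min M (N j) : ℕ) : ℝ) ≤ 1} := by
  refine Set.Subset.antisymm (ldofRegion_subset hL hM hN hlaw hindep) ?_
  rintro d ⟨hd, hreg⟩
  have hLT : ∀ k, L k ≤ min M (N k) := fun k =>
    (Finset.le_sup (f := L) (Finset.mem_univ k)).trans (le_min hM.le (hN k).le)
  have hσ : ∑ j, d j / ((min M (N j) : ℕ) : ℝ) ≤ 1 := by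
    rcases isEmpty_or_nonempty (Fin K) with hK | ⟨⟨k⟩⟩
    · simp
    · refine le_trans ?_ (hreg k)
      rw [← Finset.add_sum_erase _ _ (Finset.mem_univ k)]
      gcongr
      · exact hd k
      · exact_mod_cast hL k
      · exact hLT k
  -- multiples of `d` by factors below one satisfy the strict inequality needed below
  have hlim : Tendsto (fun i : ℕ => (1 - 1 / ((i : ℝ) + 1)) • d) atTop (𝓝 d) := by
    have h1 : Tendsto (fun i : ℕ => 1 - 1 / ((i : ℝ) + 1)) atTop (𝓝 (1 - 0)) :=
      tendsto_const_nhds.sub tendsto_one_div_add_atTop_nhds_zero_nat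
    simpa using h1.smul_const d
  refine isClosed_closure.mem_of_tendsto hlim (Eventually.of_forall fun i => ?_)
  have hpos : (0 : ℝ) < 1 / ((i : ℝ) + 1) := by positivity
  have hle : 1 / ((i : ℝ) + 1) ≤ 1 := by
    rw [div_le_one (by positivity)]
    have : (0 : ℝ) ≤ i := Nat.cast_nonneg i
    linarith
  set s : ℝ := 1 - 1 / ((i : ℝ) + 1) with hs
  have hs0 : 0 ≤ s := by linarith
  have hs1 : s < 1 := by linarith
  refine mem_ldofRegion_of_sum_lt_one hlaw hindep hL hLT (fun k => min_le_right _ _)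
    (fun k => min_le_left _ _) (fun k => mul_nonneg hs0 (hd k)) ?_ fun k => ?_
  · simp only [Pi.smul_apply, smul_eq_mul, mul_div_assoc]
    rw [← Finset.mul_sum]
    nlinarith
  · simp only [Pi.smul_apply, smul_eq_mul, mul_div_assoc]
    rw [← Finset.mul_sum, ← mul_add]
    calc _ ≤ s * 1 := mul_le_mul_of_nonneg_left (hreg k) hs0
      _ ≤ 1 := by linarith
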